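/- Let $\alpha\in(\frac13,\frac12]$, $T>0$, let $V$ be a separable real Banach space, and let $\beta_0,\dots,\beta_3\ge 0$. Write $\Phi_{s,t}=\Phi_t-\Phi_s$, $\beta^*_k=\max\{\beta_0,\dots,\beta_k\}$ and $\beta^{**}_k=\max\{\beta_1,\dots,\beta_{k+1}\}$, and equip $V^2$ with the norm $\|x_1\|+\|x_2\|$. Let $\mathbf W=(W,\mathbb W)$ be a nonlinear rough path in $\mathscr C^{\alpha,\boldsymbol\beta_3}([0,T]\times V;V)$. That is, $W:[0,T]\times V\to V$ and $\mathbb W:[0,T]^2\times V^2\to V$, where the functions $W_{s,t}$ are three times and the functions $\mathbb W_{s,t}$ are twice Fréchet differentiable in space; the seminorms $$\|W\|=\sum_{k=0}^3\sup_{s\ne t,\;x\in V}\frac{\|D^kW_{s,t}(x)\|}{|t-s|^{\alpha}(1+\|x\|)^{\beta_k}},\qquad \|\mathbb W\|=\sum_{k=0}^2\sup_{s\neq t,\;(x_1,x_2)\in V^2}\frac{\|D^k\mathbb W_{s,t}(x_1,x_2)\|}{|t-s|^{2\alpha}(1+\|x_1\|)^{\beta^*_k}(1+\|x_2\|)^{\beta^{**}_k}}$$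 are finite; and Chen's relation $$\mathbb W_{s,t}(x,y)-\mathbb W_{s,u}(x,y)-\mathbb W_{u,t}(x,y)=DW_{u,t}(y)\big(W_{s,u}(x)\big)$$ holds for all $s,u,t\in[0,T]$ and $x,y\in V$. Put $\|\mathbf W\|=\|W\|+\|\mathbb W\|$, $k_\alpha=(1-2^{1-3\alpha})^{-1}$ and $\gamma_1=\max\{\beta_0,\beta_1\}+\max\{\beta_1,\beta_2\}$. Then for every $\xi\in V$ there is an $h\in(0,T]$ such that the nonlinear rough differential equation $$Y_t=\xi+\int_0^tW(dr,Y_r)$$ has a solution $Y$ on $[0,h]$. This means that $Y:[0,h]\to V$ is $\alpha$-Hölder with $Y_0=\xi$, that $\sup_{s\ne t\in[0,h]}\|Y_{s,t}-W_{s,t}(Y_s)\|\,|t-s|^{-2\alpha}<\infty$, and that for every $t\in[0,h]$ the rough integral $$\int_0^tW(dr,Y_r)=\lim_{|\pi|\to0}\sum_{k=1}^{n}\big[W_{t_{k-1},t_k}(Y_{t_{k-1}})+\mathbb W_{t_{k-1},t_k}(Y_{t_{k-1}},Y_{t_{k-1}})\big],\qquad \pi=(0=t_0<\dots<t_n=t),$$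 exists and the equation holds. Moreover the solution can be chosen so that $$\sup_{s\ne t\in[0,h]}\frac{\|Y_{s,t}\|}{|t-s|^\alpha}\le\min\Big\{\big(1+(6\gamma_1)^{-1}\big)^{1+\beta_0}(1+\|\mathbf W\|)(1+\|\xi\|)^{\beta_0},\;2k_\alpha\Big(\frac{1+\gamma_1}{\gamma_1}\Big)^{1+\gamma_1}\|\mathbf W\|(1+2\|\xi\|)^{\gamma_1}\Big\}$$ whenever $\gamma_1>0$ (for $\gamma_1=0$ the right-hand side involves a division by zero, and no bound is claimed). -/

import Mathlib

open Set
open scoped ENNReal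

noncomputable section

/-- The increment `Φ_{s,t} = Φ_t - Φ_s`. -/
def incr {E : Type*} [AddCommGroup E] (Φ : ℝ → E) (s t : ℝ) : E := Φ t - Φ s

/-- The Hölder seminorm of exponent `γ` on `[a,b]` of a two-parameter function `R`, that is
`sup_{s ≠ t ∈ [a,b]} ‖R_{s,t}‖ / |t - s|^γ`, with value in `[0,∞]`. -/
def holderSeminormTwo {E : Type*} [NormedAddCommGroup E] (γ a b : ℝ) (R : ℝ → ℝ → E) : ℝ≥0∞ :=
  ⨆ (s ∈ Icc a b) (t ∈ Icc a b) (_ : s ≠ t), ENNReal.ofReal (‖R s t‖ / |t - s| ^ γ)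

/-- The Hölder seminorm of exponent `γ` on `[a,b]` of a path `Y`. -/
def holderSeminorm {E : Type*} [NormedAddCommGroup E] (γ a b : ℝ) (Y : ℝ → E) : ℝ≥0∞ :=
  holderSeminormTwo γ a b (incr Y)

/-- `f` is `n` times Fréchet differentiable (the derivative of order `n` need not be continuous). -/
def TimesDifferentiable {E F : Type*} [NormedAddCommGroup E] [NormedSpace ℝ E]
    [NormedAddCommGroup F] [NormedSpace ℝ F] (n : ℕ) (f : E → F) : Prop :=
  ∀ k < n, Differentiable ℝ (iteratedFDeriv ℝ k f)

section Spaces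

variable {V K : Type*} [NormedAddCommGroup V] [NormedSpace ℝ V]
  [NormedAddCommGroup K] [NormedSpace ℝ K]

/-- The seminorm of `Φ : [0,T] × V → K` with growth multi-index `β_0, …, β_n`:
`∑_{k ≤ n} sup_{s ≠ t, x} ‖D^k Φ_{s,t}(x)‖ / (|t - s|^α (1 + ‖x‖)^{β_k})`, with value in `[0,∞]`. -/
def growthSeminorm (α T : ℝ) (n : ℕ) (β : ℕ → ℝ) (Φ : ℝ → V → K) : ℝ≥0∞ :=
  ∑ k ∈ Finset.range (n + 1),
    ⨆ (s ∈ Icc 0 T) (t ∈ Icc 0 T) (_ : s ≠ t) (x : V),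
      ENNReal.ofReal
        (‖iteratedFDeriv ℝ k (incr Φ s t) x‖ / (|t - s| ^ α * (1 + ‖x‖) ^ β k))

/-- The space of functions `Φ : [0,T] × V → K` whose increments are `n` times differentiable in
space, with finite `growthSeminorm`. -/
def MemGrowth (α T : ℝ) (n : ℕ) (β : ℕ → ℝ) (Φ : ℝ → V → K) : Prop :=
  (∀ s ∈ Icc 0 T, ∀ t ∈ Icc 0 T, TimesDifferentiable n (incr Φ s t)) ∧
    growthSeminorm α T n β Φ < ∞

/-- The seminorm of `Ψ : [0,T]² × V² → K` with growth multi-indexes `β¹`, `β²`: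
`∑_{k ≤ n} sup_{s ≠ t, x} ‖D^k Ψ_{s,t}(x)‖ / (|t - s|^α (1 + ‖x₁‖)^{β¹_k} (1 + ‖x₂‖)^{β²_k})`.
Here `V²` carries the norm `‖x₁‖ + ‖x₂‖`, i.e. it is `WithLp 1 (V × V)`. -/
def growthSeminormTwo (α T : ℝ) (n : ℕ) (β₁ β₂ : ℕ → ℝ)
    (Ψ : ℝ → ℝ → WithLp 1 (V × V) → K) : ℝ≥0∞ :=
  ∑ k ∈ Finset.range (n + 1),
    ⨆ (s ∈ Icc 0 T) (t ∈ Icc 0 T) (_ : s ≠ t) (x : WithLp 1 (V × V)),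
      ENNReal.ofReal
        (‖iteratedFDeriv ℝ k (Ψ s t) x‖ /
          (|t - s| ^ α * (1 + ‖x.fst‖) ^ β₁ k * (1 + ‖x.snd‖) ^ β₂ k))

/-- The space of functions `Ψ : [0,T]² × V² → K` that are `n` times differentiable in space, with
finite `growthSeminormTwo`. -/
def MemGrowthTwo (α T : ℝ) (n : ℕ) (β₁ β₂ : ℕ → ℝ)
    (Ψ : ℝ → ℝ → WithLp 1 (V × V) → K) : Prop :=
  (∀ s ∈ Icc 0 T, ∀ t ∈ Icc 0 T, TimesDifferentiable n (Ψ s t)) ∧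
    growthSeminormTwo α T n β₁ β₂ Ψ < ∞

/-- `β*_k = max {β_0, …, β_k}`. -/
def betaStar (β : ℕ → ℝ) (k : ℕ) : ℝ := partialSups β k

/-- `β**_k = max {β_1, …, β_{k+1}}`. -/
def betaStarStar (β : ℕ → ℝ) (k : ℕ) : ℝ := partialSups (fun i => β (i + 1)) k

/-- `(W, WW)` is an `α`-Hölder nonlinear rough path on `[0,T] × V` with growth multi-index
`β_0, …, β_n` (for `n ≥ 1`). -/
structure IsNonlinearRoughPath (α T : ℝ) (n : ℕ) (β : ℕ → ℝ)
    (W : ℝ → V → V) (WW : ℝ → ℝ → WithLp 1 (V × V) → V) : Prop where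
  mem_first : MemGrowth α T n β W
  mem_second : MemGrowthTwo (2 * α) T (n - 1) (betaStar β) (betaStarStar β) WW
  /-- Chen's relation. -/
  chen : ∀ s ∈ Icc 0 T, ∀ u ∈ Icc 0 T, ∀ t ∈ Icc 0 T, ∀ x y : V,
    WW s t (WithLp.toLp 1 (x, y)) - WW s u (WithLp.toLp 1 (x, y))
        - WW u t (WithLp.toLp 1 (x, y))
      = fderiv ℝ (incr W u t) y (incr W s u x)

/-- The (finite, for a nonlinear rough path) quantity `‖(W, WW)‖`, the sum of the seminorms of the
two components. -/
def roughPathNorm (α T : ℝ) (n : ℕ) (β : ℕ → ℝ)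
    (W : ℝ → V → V) (WW : ℝ → ℝ → WithLp 1 (V × V) → V) : ℝ :=
  (growthSeminorm α T n β W +
    growthSeminormTwo (2 * α) T (n - 1) (betaStar β) (betaStarStar β) WW).toReal

/-- `(Y, Y')` is a basic controlled path on `[0,h]` with respect to `W`:
`Y`, `Y'` are `α`-Hölder and `R_{s,t} = Y_{s,t} - W_{s,t}(Y'_s)` is `2α`-Hölder. -/
structure IsControlled (α h : ℝ) (W : ℝ → V → V) (Y Y' : ℝ → V) : Prop where
  holder : holderSeminorm α 0 h Y < ∞
  holder_deriv : holderSeminorm α 0 h Y' < ∞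
  remainder : holderSeminormTwo (2 * α) 0 h (fun s t => incr Y s t - incr W s t (Y' s)) < ∞

/-- `I` is the nonlinear rough integral `∫_s^t W(dr, Y_r)` of `(Y, Y')`: the limit, as the mesh of
the partitions `s = π_0 < π_1 < ⋯ < π_m = t` tends to zero, of
`∑_k [W_{π_k,π_{k+1}}(Y_{π_k}) + WW_{π_k,π_{k+1}}(Y'_{π_k}, Y_{π_k})]`. -/
def IsRoughIntegral (W : ℝ → V → V) (WW : ℝ → ℝ → WithLp 1 (V × V) → V)
    (Y Y' : ℝ → V) (s t : ℝ) (I : V) : Prop :=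
  ∀ ε > 0, ∃ δ > 0, ∀ (m : ℕ) (π : ℕ → ℝ), π 0 = s → π m = t →
    (∀ k < m, π k < π (k + 1)) → (∀ k < m, π (k + 1) - π k < δ) →
    ‖∑ k ∈ Finset.range m,
        (incr W (π k) (π (k + 1)) (Y (π k))
          + WW (π k) (π (k + 1)) (WithLp.toLp 1 (Y' (π k), Y (π k)))) - I‖ < ε

/-- `Y` solves `Y_t = ξ + ∫_0^t W(dr, Y_r)` on `[0,h]`: the pair `(Y, Y)` is controlled by `W` on
`[0,h]` and starts at `(ξ, ξ)`, and for all `t ∈ [0,h]` the rough integral exists and the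
equation holds. -/
structure IsRDESolution (α h : ℝ) (W : ℝ → V → V) (WW : ℝ → ℝ → WithLp 1 (V × V) → V)
    (ξ : V) (Y : ℝ → V) : Prop where
  controlled : IsControlled α h W Y Y
  initial : Y 0 = ξ
  equation : ∀ t ∈ Icc 0 h, ∃ I : V, IsRoughIntegral W WW Y Y 0 t I ∧ Y t = ξ + I

end Spaces

/-- `k_α = (1 - 2^{1 - 3α})⁻¹`. -/
def kConst (α : ℝ) : ℝ := (1 - (2 : ℝ) ^ (1 - 3 * α))⁻¹

/-- `γ₁ = β₀ ∨ β₁ + β₁ ∨ β₂`. -/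
def gammaOne (β : ℕ → ℝ) : ℝ := max (β 0) (β 1) + max (β 1) (β 2)

end

/-! The one-step map `φ s t x = x + W_{s,t}(x) + WW_{s,t}(x, x)` is a flow up to an error of order
`3α > 1`. Chen's relation reduces `φ u t ∘ φ s u - φ s t` to a second-order Taylor remainder of
`W_{u,t}` and terms pairing a `WW` with a first-order quantity. Near `ξ` all of these are of order
`|t - s|^(3α)`, and the third derivative of `W` makes them Lipschitz in `x` to the same order
(`exists_isAlmostFlow`).

For such an almost flow, the scheme obtained by iterating `φ` on a uniform grid stays within `λC|t -
s|^q` of a single application of `φ`, uniformly in the mesh, for `1 < q < 3α`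
(`eulerScheme_estimate`). Schemes on the grids of mesh `δ` and `δ/2` differ by at most a multiple of
`δ^(3α - q)` (`eulerScheme_halve`). The dyadic schemes are therefore Cauchy, and completeness gives
a limit `Y` without any compactness (`exists_path`). Both estimates are sewing arguments carried by
`exists_discrete_sewing`, which tolerates a factor `ρ > 1` on one of the two subintervals; this
absorbs the Lipschitz constant `1 + C h^a` of `φ`.

The limit satisfies `‖Y t - φ s t (Y s)‖ ≤ K (t - s)^q` with `q > 1`, so the compensated Riemann
sums converge to its increment and `Y` solves the equation. On a short interval the leading term of
`Y_{s,t}` is `W_{s,t}(Y_s)`, so the Hölder seminorm can be brought below any number larger than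
`‖𝐖‖(1 + ‖ξ‖)^β₀`. The claimed bound is strictly larger than this unless `‖𝐖‖ = 0`, when constant
paths are solutions. -/

/-! ### Discrete sewing -/

/-- A discrete sewing inequality. -/
theorem exists_discrete_sewing {q : ℝ} (hq : 1 < q) :
    ∃ ρ > (1 : ℝ), ∃ lam > (1 : ℝ), ∀ (N : ℕ) (J : ℕ → ℕ → ℝ) (c : ℝ), 0 ≤ c →
      (∀ i ≤ N, J i i ≤ 0) → (∀ i < N, J i (i + 1) ≤ c) →
      (∀ i j k, i < j → j < k → k ≤ N →
        J i k ≤ ρ * J i j + J j k + c * ((k : ℝ) - i) ^ q) →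
      ∀ i k, i ≤ k → k ≤ N → J i k ≤ lam * c * ((k : ℝ) - i) ^ q := by
  set η : ℝ := (2 : ℝ) ^ (1 - q) with hη
  have hη0 : 0 < η := Real.rpow_pos_of_pos two_pos _
  have hη1 : η < 1 := Real.rpow_lt_one_of_one_lt_of_neg one_lt_two (by linarith)
  have h2q : ((1 : ℝ) / 2) ^ q = η / 2 := by
    rw [hη, Real.rpow_sub two_pos, Real.rpow_one, one_div, Real.inv_rpow two_pos.le]
    field_simp
  -- Each half of an interval contributes a factor `η / 2`, so the recursion closes as soon as `η (1
  -- + ρ) / 2 < 1`. With `ρ = 2 - η` and `λ (1 - η) = 8`, the halves give `λη + 4η` and the additive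
  -- errors give `4`, in total at most `λη + 8 = λ`.
  refine ⟨1 + (1 - η), by linarith, 8 / (1 - η), ?_, ?_⟩
  · rw [gt_iff_lt, lt_div_iff₀ (by linarith)]; linarith
  intro N J c hc h0 h1 hJ
  set lam : ℝ := 8 / (1 - η) with hlam
  have hlam' : lam * (1 - η) = 8 := div_mul_cancel₀ _ (by linarith)
  have hlam1 : 8 ≤ lam := by rw [hlam, le_div_iff₀ (by linarith)]; linarith
  have key : ∀ m i : ℕ, i + m ≤ N → J i (i + m) ≤ lam * c * (m : ℝ) ^ q := by
    intro m
    induction m using Nat.strong_induction_on with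
    | _ m ih =>
    intro i hi
    rcases Nat.lt_or_ge m 2 with hm | hm
    · interval_cases m
      · simpa [Real.zero_rpow (by linarith : q ≠ 0)] using h0 i hi
      · refine (h1 i hi).trans ?_
        simp only [Nat.cast_one, Real.one_rpow, mul_one]
        nlinarith
    · have half : ∀ n : ℕ, 2 * n ≤ m → lam * c * (n : ℝ) ^ q ≤ lam * c * (m : ℝ) ^ q * (η / 2) := by
        intro n hn
        have : (n : ℝ) ^ q ≤ (m : ℝ) ^ q * (η / 2) := by
          rw [← h2q, ← Real.mul_rpow (by positivity) (by norm_num)]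
          apply Real.rpow_le_rpow (by positivity) _ (by linarith)
          have : (2 * n : ℝ) ≤ m := by exact_mod_cast hn
          linarith
        rw [mul_assoc]
        rw [mul_assoc]
        rw [mul_assoc]
        gcongr
      have hm1 : (1 : ℝ) ≤ (m : ℝ) ^ q :=
        Real.one_le_rpow (by exact_mod_cast (by omega : 1 ≤ m)) (by linarith)
      set X : ℝ := (m : ℝ) ^ q with hX
      have hcX : c ≤ c * X := le_mul_of_one_le_right hc hm1
      have hcX0 : 0 ≤ c * X := hc.trans hcX
      have e1 := (ih (m / 2) (by omega) i (by omega)).trans (half _ (by omega))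
      have e2 := hJ i (i + m / 2) (i + m) (by omega) (by omega) hi
      -- The upper half may be longer than `m / 2`. Peeling off one step, at cost `ρc ≤ 2c` plus one
      -- error term, leaves a length to which `half` applies.
      have e3 : J (i + m / 2) (i + m) ≤ lam * c * X * (η / 2) + 3 * (c * X) := by
        by_cases hjk : i + m / 2 + 1 = i + m
        · rw [← hjk]
          have := h1 (i + m / 2) (by omega)
          have : 0 ≤ lam * c * X * (η / 2) := by
            have : 0 ≤ lam := by linarith
            positivity
          linarith
        · have e4 := hJ (i + m / 2) (i + m / 2 + 1) (i + m) (by omega) (by omega) hi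
          have e5 := (ih (m - m / 2 - 1) (by omega) (i + m / 2 + 1) (by omega)).trans
            (half _ (by omega))
          rw [show i + m / 2 + 1 + (m - m / 2 - 1) = i + m by omega] at e5
          have e6 := h1 (i + m / 2) (by omega)
          have e7 : (((i + m : ℕ) : ℝ) - ((i + m / 2 : ℕ) : ℝ)) ^ q ≤ X := by
            rw [hX]
            have : ((m / 2 : ℕ) : ℝ) ≤ m := by exact_mod_cast Nat.div_le_self _ _
            apply Real.rpow_le_rpow _ _ (by linarith)
            · push_cast; linarith
            · push_cast; linarith [(Nat.cast_nonneg (m / 2) : (0 : ℝ) ≤ _)]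
          have e8 := mul_le_mul_of_nonneg_left e7 hc
          have e9 : (1 + (1 - η)) * J (i + m / 2) (i + m / 2 + 1) ≤ 2 * c := by nlinarith
          linarith
      have e10 : ((i + m : ℕ) : ℝ) - i = m := by push_cast; ring
      rw [e10, ← hX] at e2
      have e11 := mul_le_mul_of_nonneg_left e1 (by linarith : 0 ≤ 1 + (1 - η))
      have e12 : lam * c * X = lam * (1 - η) * (c * X) + lam * c * X * η := by ring
      rw [hlam'] at e12
      have e13 : lam * c * X * η * (1 - η) = lam * (1 - η) * (c * X) * η := by ring
      rw [hlam'] at e13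
      have e14 : 8 * (c * X) * η ≤ 8 * (c * X) := by nlinarith
      nlinarith
  intro i k hik hk
  obtain ⟨m, rfl⟩ := Nat.exists_eq_add_of_le hik
  have := key m i hk
  rwa [show ((i + m : ℕ) : ℝ) - i = m by push_cast; ring]

/-! ### Four-point and Taylor estimates -/

section Calculus

variable {E F : Type*} [NormedAddCommGroup E] [NormedSpace ℝ E]
  [NormedAddCommGroup F] [NormedSpace ℝ F]

/-- Second order differences of a function with bounded and Lipschitz derivative. -/
theorem Convex.norm_four_point_le {s : Set E} (hs : Convex ℝ s) {G : E → F} {G' : E → E →L[ℝ] F}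
    {c : ℝ} (hG : ∀ x ∈ s, HasFDerivAt G (G' x) x) (hb : ∀ x ∈ s, ‖G' x‖ ≤ c)
    (hl : ∀ x ∈ s, ∀ y ∈ s, ‖G' x - G' y‖ ≤ c * ‖x - y‖) {x x' y y' : E}
    (hx : x ∈ s) (hx' : x' ∈ s) (hy : y ∈ s) (hy' : y' ∈ s) :
    ‖G x - G x' - (G y - G y')‖ ≤
      c * (‖x - x' - (y - y')‖ + (‖x - y‖ + ‖x' - y'‖) * ‖x - x'‖) := by
  have hc : 0 ≤ c := (norm_nonneg _).trans (hb x hx)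
  have hp : ∀ {x x' : E}, x ∈ s → x' ∈ s → ∀ θ ∈ Icc (0 : ℝ) 1, x' + θ • (x - x') ∈ s :=
    fun hx hx' θ hθ => hs.add_smul_sub_mem hx' hx hθ
  have hd : ∀ {x x' : E}, x ∈ s → x' ∈ s → ∀ θ ∈ Icc (0 : ℝ) 1,
      HasDerivAt (fun θ : ℝ => G (x' + θ • (x - x'))) (G' (x' + θ • (x - x')) (x - x')) θ := by
    intro x x' hx hx' θ hθ
    have h1 : HasDerivAt (fun θ : ℝ => x' + θ • (x - x')) (x - x') θ := by
      simpa using ((hasDerivAt_id θ).smul_const (x - x')).const_add x'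
    exact (hG _ (hp hx hx' θ hθ)).comp_hasDerivAt θ h1
  have := norm_image_sub_le_of_norm_deriv_le_segment_01'
    (f := fun θ : ℝ => G (x' + θ • (x - x')) - G (y' + θ • (y - y')))
    (f' := fun θ => G' (x' + θ • (x - x')) (x - x') - G' (y' + θ • (y - y')) (y - y'))
    (C := c * (‖x - x' - (y - y')‖ + (‖x - y‖ + ‖x' - y'‖) * ‖x - x'‖))
    (fun θ hθ => ((hd hx hx' θ hθ).sub (hd hy hy' θ hθ)).hasDerivWithinAt) ?_
  · refine le_trans (le_of_eq ?_) this
    congr 1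
    simp only [one_smul, zero_smul, add_zero, add_sub_cancel]
    abel
  intro θ hθ
  have hθ' : θ ∈ Icc (0 : ℝ) 1 := ⟨hθ.1, hθ.2.le⟩
  set a := x' + θ • (x - x') with ha
  set b := y' + θ • (y - y') with hb'
  -- The difference of derivatives is made to act on `x - x'`. In the application this is the local
  -- error of a scheme, already of order `q`.
  have e : G' a (x - x') - G' b (y - y') = (G' a - G' b) (x - x') + G' b (x - x' - (y - y')) := by
    simp only [_root_.sub_apply, map_sub]; abel
  have hab : ‖a - b‖ ≤ ‖x - y‖ + ‖x' - y'‖ := by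
    have : a - b = θ • (x - y) + (1 - θ) • (x' - y') := by
      rw [ha, hb']; module
    rw [this]
    refine (norm_add_le _ _).trans ?_
    rw [norm_smul, norm_smul, Real.norm_of_nonneg hθ.1, Real.norm_of_nonneg (by linarith [hθ.2])]
    nlinarith [norm_nonneg (x - y), norm_nonneg (x' - y'), hθ.1, hθ.2]
  rw [e]
  calc ‖(G' a - G' b) (x - x') + G' b (x - x' - (y - y'))‖
      ≤ ‖G' a - G' b‖ * ‖x - x'‖ + ‖G' b‖ * ‖x - x' - (y - y')‖ :=
        (norm_add_le _ _).trans (add_le_add (ContinuousLinearMap.le_opNorm _ _)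
          (ContinuousLinearMap.le_opNorm _ _))
    _ ≤ (c * (‖x - y‖ + ‖x' - y'‖)) * ‖x - x'‖ + c * ‖x - x' - (y - y')‖ := by
        gcongr
        · exact (hl a (hp hx hx' θ hθ') b (hp hy hy' θ hθ')).trans (by gcongr)
        · exact hb b (hp hy hy' θ hθ')
    _ = _ := by ring

/-- First order Taylor estimate for a function with Lipschitz derivative. -/
theorem Convex.norm_taylor_le {s : Set E} (hs : Convex ℝ s) {G : E → F} {G' : E → E →L[ℝ] F}
    {c : ℝ} (hc : 0 ≤ c) (hG : ∀ x ∈ s, HasFDerivAt G (G' x) x)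
    (hl : ∀ x ∈ s, ∀ y ∈ s, ‖G' x - G' y‖ ≤ c * ‖x - y‖) {x z : E} (hx : x ∈ s) (hz : z ∈ s) :
    ‖G z - G x - G' x (z - x)‖ ≤ c * ‖z - x‖ * ‖z - x‖ := by
  have hseg : segment ℝ x z ⊆ s := hs.segment_subset hx hz
  refine (convex_segment x z).norm_image_sub_le_of_norm_hasFDerivWithin_le' (f' := G')
    (fun y hy => (hG y (hseg hy)).hasFDerivWithinAt) (fun y hy => ?_)
    (left_mem_segment ℝ x z) (right_mem_segment ℝ x z)
  refine (hl y (hseg hy) x hx).trans ?_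
  gcongr
  obtain ⟨θ, hθ, rfl⟩ := (segment_eq_image' ℝ x z) ▸ hy
  simp only [add_sub_cancel_left, norm_smul, Real.norm_of_nonneg hθ.1]
  exact mul_le_of_le_one_left (norm_nonneg _) hθ.2

end Calculus

/-! ### Almost flows and their Euler schemes -/

section AlmostFlow

variable {E : Type*} [NormedAddCommGroup E]

/-- A family of maps that is, up to an error of order `p`, a flow near `ξ` on `[0, H]`. -/
structure IsAlmostFlow (a p H C : ℝ) (ξ : E) (φ : ℝ → ℝ → E → E) : Prop where
  norm_sub_le : ∀ s t, 0 ≤ s → s ≤ t → t ≤ H → ∀ x ∈ Metric.closedBall ξ 2,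
    ‖φ s t x - x‖ ≤ C * (t - s) ^ a
  lipschitz : ∀ s t, 0 ≤ s → s ≤ t → t ≤ H → ∀ x ∈ Metric.closedBall ξ 2,
    ∀ y ∈ Metric.closedBall ξ 2, ‖φ s t x - x - (φ s t y - y)‖ ≤ C * (t - s) ^ a * ‖x - y‖
  four_point : ∀ s t, 0 ≤ s → s ≤ t → t ≤ H → ∀ x ∈ Metric.closedBall ξ 2,
    ∀ x' ∈ Metric.closedBall ξ 2, ∀ y ∈ Metric.closedBall ξ 2, ∀ y' ∈ Metric.closedBall ξ 2,
    ‖φ s t x - x - (φ s t x' - x') - (φ s t y - y - (φ s t y' - y'))‖ ≤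
      C * (t - s) ^ a * (‖x - x' - (y - y')‖ + (‖x - y‖ + ‖x' - y'‖) * ‖x - x'‖)
  defect : ∀ s u t, 0 ≤ s → s ≤ u → u ≤ t → t ≤ H → ∀ x ∈ Metric.closedBall ξ 1,
    ‖φ u t (φ s u x) - φ s t x‖ ≤ C * (t - s) ^ p
  defect_lipschitz : ∀ s u t, 0 ≤ s → s ≤ u → u ≤ t → t ≤ H → ∀ x ∈ Metric.closedBall ξ 1,
    ∀ y ∈ Metric.closedBall ξ 1,
    ‖φ u t (φ s u x) - φ s t x - (φ u t (φ s u y) - φ s t y)‖ ≤ C * (t - s) ^ p * ‖x - y‖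
  time_holder : ∀ s s' t t', 0 ≤ s' → s' ≤ s → t' ≤ t → s ≤ t → s' ≤ t' → t ≤ H →
    ∀ x ∈ Metric.closedBall ξ 1, ‖φ s' t' x - φ s t x‖ ≤ C * ((s - s') ^ a + (t - t') ^ a)

/-- The scheme `y_{n+1} = φ_{nδ,(n+1)δ}(y_n)`, `y_0 = ξ`. -/
def eulerScheme (φ : ℝ → ℝ → E → E) (ξ : E) (δ : ℝ) : ℕ → E
  | 0 => ξ
  | n + 1 => φ (n * δ) ((n + 1 : ℕ) * δ) (eulerScheme φ ξ δ n)

/-- The conditions that make a time horizon `h` short. -/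
structure ShortTime (a q C ρ lam h : ℝ) : Prop where
  pos : 0 < h
  le_one : h ≤ 1
  le_rho : 1 + C * h ^ a ≤ ρ
  le_half : C * h ^ a ≤ 1 / 2
  le_half' : lam * C * h ^ q ≤ 1 / 2
  le_half'' : lam * ((2 * lam + 1) * C) * h ^ q ≤ 1 / 2

theorem eventually_mul_rpow_le {b c : ℝ} (hb : 0 < b) (A : ℝ) (hc : 0 < c) :
    ∀ᶠ h : ℝ in nhdsWithin 0 (Ioi 0), A * h ^ b ≤ c := by
  have h1 : Filter.Tendsto (fun h : ℝ => A * h ^ b) (nhds 0) (nhds (A * 0 ^ b)) :=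
    ((Real.continuousAt_rpow_const 0 b (Or.inr hb.le)).tendsto).const_mul A
  rw [Real.zero_rpow hb.ne', mul_zero] at h1
  exact (h1.mono_left nhdsWithin_le_nhds).eventually_le_const hc

theorem exists_shortTime {a q C ρ lam H : ℝ} (ha : 0 < a) (hq : 0 < q) (hρ : 1 < ρ) (hH : 0 < H) :
    ∃ h ≤ H, ShortTime a q C ρ lam h := by
  have h1 : ∀ᶠ h : ℝ in nhdsWithin 0 (Ioi 0), h ≤ min H 1 :=
    (Filter.tendsto_id.mono_left nhdsWithin_le_nhds).eventually_le_const (by positivity)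
  have hhalf : (0 : ℝ) < 1 / 2 := one_half_pos
  obtain ⟨h, h2, h3, h4, h5, h6, h7⟩ := (Filter.Eventually.and
    (self_mem_nhdsWithin : Ioi (0 : ℝ) ∈ _) (h1.and
    ((eventually_mul_rpow_le ha C (sub_pos.mpr hρ)).and
    ((eventually_mul_rpow_le ha C hhalf).and
    ((eventually_mul_rpow_le hq (lam * C) hhalf).and
      (eventually_mul_rpow_le hq (lam * ((2 * lam + 1) * C)) hhalf)))))).exists
  exact ⟨h, h3.trans (min_le_left _ _), h2, h3.trans (min_le_right _ _), by linarith, h5, h6, h7⟩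

namespace IsAlmostFlow

variable {a p q H C ρ lam h : ℝ} {ξ : E} {φ : ℝ → ℝ → E → E}

theorem nonneg (hφ : IsAlmostFlow a p H C ξ φ) (hH : 0 < H) : 0 ≤ C := by
  have := (norm_nonneg _).trans
    (hφ.norm_sub_le 0 H le_rfl hH.le le_rfl ξ (Metric.mem_closedBall_self two_pos.le))
  rw [sub_zero] at this
  exact nonneg_of_mul_nonneg_left this (Real.rpow_pos_of_pos hH a)

theorem mem_closedBall_two (x : E) (hx : x ∈ Metric.closedBall ξ 1) : x ∈ Metric.closedBall ξ 2 :=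
  Metric.closedBall_subset_closedBall one_le_two hx

variable (hφ : IsAlmostFlow a p H C ξ φ) (ha : 0 < a) (hq : 1 < q) (hqp : q ≤ p)
  (hS : ShortTime a q C ρ lam h) (hH : h ≤ H)

theorem mul_rpow_le (hC : 0 ≤ C) (ha : 0 < a) {s t : ℝ} (hs : 0 ≤ s) (hst : s ≤ t)
    (ht : t ≤ h) : C * (t - s) ^ a ≤ C * h ^ a := by
  gcongr
  linarith

theorem mul_rpow_le' (hC : 0 ≤ C) (hqp : q ≤ p) (h1 : h ≤ 1) {s t : ℝ}
    (hs : 0 ≤ s) (hst : s ≤ t) (ht : t ≤ h) (hq : 0 < q) : C * (t - s) ^ p ≤ C * (t - s) ^ q := by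
  gcongr C * ?_
  rcases hst.eq_or_lt with rfl | hst
  · rw [sub_self, Real.zero_rpow hq.ne', Real.zero_rpow (by linarith)]
  · exact Real.rpow_le_rpow_of_exponent_ge (by linarith) (by linarith) hqp

include hφ ha hS hH in
theorem map_mem {s t : ℝ} (hs : 0 ≤ s) (hst : s ≤ t) (ht : t ≤ h) {x : E}
    (hx : x ∈ Metric.closedBall ξ 1) : φ s t x ∈ Metric.closedBall ξ 2 := by
  have hC := hφ.nonneg (hS.pos.trans_le hH)
  have h1 := hφ.norm_sub_le s t hs hst (ht.trans hH) x (mem_closedBall_two x hx)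
  have h2 := mul_rpow_le hC ha hs hst ht
  have h3 := hS.le_half
  rw [mem_closedBall_iff_norm] at hx ⊢
  calc ‖φ s t x - ξ‖ = ‖(φ s t x - x) + (x - ξ)‖ := by congr 1; abel
    _ ≤ _ := norm_add_le _ _
    _ ≤ 2 := by linarith

include hφ ha in
theorem apply_self {s : ℝ} (hs : 0 ≤ s) (hs' : s ≤ H) {x : E} (hx : x ∈ Metric.closedBall ξ 2) :
    φ s s x = x := by
  have := hφ.norm_sub_le s s hs le_rfl hs' x hx
  rw [sub_self, Real.zero_rpow ha.ne', mul_zero] at this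
  exact sub_eq_zero.mp (norm_le_zero_iff.mp this)

include hφ ha hS hH in
theorem norm_map_sub_le {s t : ℝ} (hs : 0 ≤ s) (hst : s ≤ t) (ht : t ≤ h) {x y : E}
    (hx : x ∈ Metric.closedBall ξ 2) (hy : y ∈ Metric.closedBall ξ 2) :
    ‖φ s t x - φ s t y‖ ≤ (1 + C * h ^ a) * ‖x - y‖ := by
  have hC := hφ.nonneg (hS.pos.trans_le hH)
  have h1 := hφ.lipschitz s t hs hst (ht.trans hH) x hx y hy
  have h2 := mul_rpow_le hC ha hs hst ht
  have h3 := mul_le_mul_of_nonneg_right h2 (norm_nonneg (x - y))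
  calc ‖φ s t x - φ s t y‖ = ‖(φ s t x - x - (φ s t y - y)) + (x - y)‖ := by congr 1; abel
    _ ≤ _ := norm_add_le _ _
    _ ≤ _ := by linarith

/-- The property of `ρ` and `lam` given by `exists_discrete_sewing`. -/
def _root_.DiscreteSewing (q ρ lam : ℝ) : Prop :=
  ∀ (N : ℕ) (J : ℕ → ℕ → ℝ) (c : ℝ), 0 ≤ c →
      (∀ i ≤ N, J i i ≤ 0) → (∀ i < N, J i (i + 1) ≤ c) →
      (∀ i j k, i < j → j < k → k ≤ N →
        J i k ≤ ρ * J i j + J j k + c * ((k : ℝ) - i) ^ q) →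
      ∀ i k, i ≤ k → k ≤ N → J i k ≤ lam * c * ((k : ℝ) - i) ^ q

variable (hsew : DiscreteSewing q ρ lam)

theorem grid_rpow {δ : ℝ} (hδ : 0 ≤ δ) {i k : ℕ} (hik : i ≤ k) :
    ((k : ℝ) * δ - i * δ) ^ q = δ ^ q * ((k : ℝ) - i) ^ q := by
  rw [← sub_mul, mul_comm, Real.mul_rpow hδ]
  have : (i : ℝ) ≤ k := by exact_mod_cast hik
  linarith

include hφ ha hq hqp hS hH hsew in
-- The error over `[i, l]` is the error over `[i, j]` transported by a map with Lipschitz constant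
-- at most `ρ`, plus the error over `[j, l]`, plus a defect: this is the sewing hypothesis. The
-- bounds on `φ` hold only near `ξ`, so confinement to the unit ball is proved in the same
-- induction.
theorem eulerScheme_estimate (hlam : 1 < lam) {δ : ℝ} (hδ : 0 < δ) (k : ℕ) (hk : k * δ ≤ h) :
    eulerScheme φ ξ δ k ∈ Metric.closedBall ξ 1 ∧ ∀ i ≤ k,
      ‖eulerScheme φ ξ δ k - φ (i * δ) (k * δ) (eulerScheme φ ξ δ i)‖ ≤
        lam * C * (k * δ - i * δ) ^ q := by
  have hC := hφ.nonneg (hS.pos.trans_le hH)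
  set y := eulerScheme φ ξ δ with hy
  have mono : ∀ {i j : ℕ}, i ≤ j → (i : ℝ) * δ ≤ j * δ := fun hij => by gcongr
  have nn : ∀ i : ℕ, 0 ≤ (i : ℝ) * δ := fun i => by positivity
  induction k using Nat.strong_induction_on with
  | _ k ih =>
  have hmem : ∀ i < k, y i ∈ Metric.closedBall ξ 1 := fun i hi =>
    (ih i hi ((mono hi.le).trans hk)).1
  have hsucc : ∀ i, y (i + 1) = φ (i * δ) ((i + 1 : ℕ) * δ) (y i) := fun i => rfl
  rcases Nat.eq_zero_or_pos k with rfl | hk0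
  · have h0 : y 0 = ξ := rfl
    refine ⟨by simp [h0], fun i hi => ?_⟩
    obtain rfl := Nat.le_zero.mp hi
    have : φ (((0 : ℕ) : ℝ) * δ) (((0 : ℕ) : ℝ) * δ) (y 0) = y 0 :=
      hφ.apply_self ha (nn 0) (hk.trans hH) (by simp [h0])
    rw [this, sub_self, sub_self, norm_zero, Real.zero_rpow (by linarith), mul_zero]
  -- At `i = j = k` the error is replaced by `0`: its vanishing requires `y k` to lie in the ball,
  -- which is not yet known.
  have main := hsew k (fun i j => if j < k ∨ i < k then
    ‖y j - φ (i * δ) (j * δ) (y i)‖ else 0) (C * δ ^ q)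
    (by positivity) ?_ ?_ ?_
  · have hR : ∀ i < k, ‖y k - φ (i * δ) (k * δ) (y i)‖ ≤ lam * C * (k * δ - i * δ) ^ q := by
      intro i hi
      have := main i k hi.le le_rfl
      rw [if_pos (Or.inr hi)] at this
      rw [grid_rpow hδ.le hi.le]
      linarith
    -- Half of the radius pays for the sewing error from time `0`, the other half for the
    -- displacement of `ξ` under `φ`.
    have hball : y k ∈ Metric.closedBall ξ 1 := by
      have h1 := hR 0 hk0
      have h0 : y 0 = ξ := rfl
      have h2 := hφ.norm_sub_le _ _ (nn 0) (mono hk0.le) (hk.trans hH) ξ (by simp)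
      have h3 := mul_rpow_le hC ha (nn 0) (mono hk0.le) hk
      have h4 : lam * C * ((k : ℝ) * δ - (0 : ℕ) * δ) ^ q ≤ 1 / 2 := by
        refine le_trans ?_ hS.le_half'
        have := nn k
        have hl : 0 ≤ lam * C := by positivity
        gcongr
        · simpa using this
        · simpa using hk
      have h5 := hS.le_half
      rw [h0] at h1
      rw [mem_closedBall_iff_norm]
      calc ‖y k - ξ‖ = ‖(y k - φ ((0 : ℕ) * δ) (k * δ) ξ) + (φ ((0 : ℕ) * δ) (k * δ) ξ - ξ)‖ := by
            congr 1; abel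
        _ ≤ _ := norm_add_le _ _
        _ ≤ 1 := (add_le_add (h1.trans h4) (h2.trans (h3.trans h5))).trans (by norm_num)
    refine ⟨hball, fun i hi => ?_⟩
    rcases hi.eq_or_lt with rfl | hi
    · rw [hφ.apply_self ha (nn i) (hk.trans hH) (mem_closedBall_two _ hball)]
      rw [sub_self, sub_self, norm_zero, Real.zero_rpow (by linarith), mul_zero]
    · exact hR i hi
  · intro i hi
    split_ifs with h1
    · have hi' : i < k := by simpa using h1
      rw [hφ.apply_self ha (nn i) ((mono hi).trans (hk.trans hH)) (mem_closedBall_two _ (hmem i hi'))]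
      simp
    · exact le_rfl
  · intro i hi
    rw [if_pos (Or.inr hi), hsucc, sub_self, norm_zero]
    positivity
  · intro i j l hij hjl hl
    rw [if_pos (Or.inr (by omega)), if_pos (Or.inr (by omega)), if_pos (Or.inr (by omega)),
      mul_assoc, ← grid_rpow hδ.le (by omega)]
    have hlh : (l : ℝ) * δ ≤ h := (mono hl).trans hk
    have hjh : (j : ℝ) * δ ≤ h := (mono hjl.le).trans hlh
    have h1 := hφ.norm_map_sub_le ha hS hH (nn j) (mono hjl.le) hlh
      (mem_closedBall_two _ (hmem j (by omega)))
      (hφ.map_mem ha hS hH (nn i) (mono hij.le) hjh (hmem i (by omega)))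
    have h2 := hφ.defect _ _ _ (nn i) (mono hij.le) (mono hjl.le) (hlh.trans hH) (y i)
      (hmem i (by omega))
    have h3 := mul_rpow_le' hC hqp hS.le_one (nn i) (mono (hij.trans hjl).le) hlh (by linarith)
    have h4 := mul_le_mul_of_nonneg_right hS.le_rho
      (norm_nonneg (y j - φ (i * δ) (j * δ) (y i)))
    set A := y l - φ (j * δ) (l * δ) (y j)
    set B := φ (j * δ) (l * δ) (y j) - φ (j * δ) (l * δ) (φ (i * δ) (j * δ) (y i))
    set D := φ (j * δ) (l * δ) (φ (i * δ) (j * δ) (y i)) - φ (i * δ) (l * δ) (y i)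
    have h5 : y l - φ (i * δ) (l * δ) (y i) = A + B + D := by simp only [A, B, D]; abel
    rw [h5]
    have h6 := norm_add₃_le (a := A) (b := B) (c := D)
    linarith

include hφ ha hq hqp hS hH hsew in
-- Sewing is applied to the difference of the local errors of the two schemes. Over one coarse step
-- this is a single defect, at most `C δ^p = C δ^(p - q) δ^q`. The four-point and Lipschitz-defect
-- bounds introduce the largest distance `S` between the schemes, with a coefficient that a short
-- horizon makes at most `1/2`, so it is absorbed.
theorem eulerScheme_halve (hlam : 1 < lam) {δ : ℝ} (hδ : 0 < δ) (k : ℕ) (hk : k * δ ≤ h) :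
    ‖eulerScheme φ ξ (δ / 2) (2 * k) - eulerScheme φ ξ δ k‖ ≤ 2 * lam * C * δ ^ (p - q) := by
  have hC := hφ.nonneg (hS.pos.trans_le hH)
  set y := eulerScheme φ ξ δ with hy
  set z : ℕ → E := fun i => eulerScheme φ ξ (δ / 2) (2 * i) with hz
  have mono : ∀ {i j : ℕ}, i ≤ j → (i : ℝ) * δ ≤ j * δ := fun hij => by gcongr
  have nn : ∀ i : ℕ, 0 ≤ (i : ℝ) * δ := fun i => by positivity
  have two : ∀ i : ℕ, ((2 * i : ℕ) : ℝ) * (δ / 2) = i * δ := fun i => by push_cast; ring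
  have hym : ∀ i ≤ k, y i ∈ Metric.closedBall ξ 1 := fun i hi =>
    (hφ.eulerScheme_estimate ha hq hqp hS hH hsew hlam hδ i ((mono hi).trans hk)).1
  have hze : ∀ j ≤ k, z j ∈ Metric.closedBall ξ 1 ∧ ∀ i ≤ j,
      ‖z j - φ (i * δ) (j * δ) (z i)‖ ≤ lam * C * (j * δ - i * δ) ^ q := by
    intro j hj
    have := hφ.eulerScheme_estimate ha hq hqp hS hH hsew hlam (half_pos hδ) (2 * j)
      (by rw [two]; exact (mono hj).trans hk)
    refine ⟨this.1, fun i hi => ?_⟩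
    have h2 := this.2 (2 * i) (by omega)
    rwa [two, two] at h2
  obtain ⟨m, hm, hmax⟩ := Finset.exists_max_image (Finset.range (k + 1)) (fun i => ‖z i - y i‖)
    ⟨0, by simp⟩
  set S := ‖z m - y m‖ with hSdef
  have hSle : ∀ i ≤ k, ‖z i - y i‖ ≤ S := fun i hi => hmax i (by simp; omega)
  have hS0 : 0 ≤ S := norm_nonneg _
  have hmk : m ≤ k := by simpa [Nat.lt_succ_iff] using hm
  -- Evaluated between `0`, where the schemes agree, and the maximizing index `m`, the left-hand
  -- side is `S` itself.
  have main := hsew k (fun i j => ‖z j - φ (i * δ) (j * δ) (z i) -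
    (y j - φ (i * δ) (j * δ) (y i))‖) ((2 * lam + 1) * C * S * δ ^ q + C * δ ^ p)
    (by positivity) ?_ ?_ ?_ 0 m (by omega) hmk
  · have h0 : z 0 = y 0 := rfl
    have e1 : z m - φ ((0 : ℕ) * δ) (m * δ) (z 0) - (y m - φ ((0 : ℕ) * δ) (m * δ) (y 0))
      = z m - y m := by rw [h0]; abel
    have e2 := grid_rpow (q := q) hδ.le (Nat.zero_le m)
    have e3 : ((m : ℝ) * δ - (0 : ℕ) * δ) ^ q ≤ h ^ q := by
      have := nn m
      gcongr
      · simpa using this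
      · simpa using (mono hmk).trans hk
    have e4 : h ^ q ≤ 1 := Real.rpow_le_one hS.pos.le hS.le_one (by linarith)
    have e5 : δ ^ p = δ ^ (p - q) * δ ^ q := by
      rw [← Real.rpow_add hδ]; congr 1; ring
    have e6 : S ≤ lam * ((2 * lam + 1) * C) * h ^ q * S + lam * C * δ ^ (p - q) := by
      calc S = ‖z m - φ ((0 : ℕ) * δ) (m * δ) (z 0) -
              (y m - φ ((0 : ℕ) * δ) (m * δ) (y 0))‖ := by rw [e1]
        _ ≤ _ := main
        _ = lam * ((2 * lam + 1) * C) * S * (δ ^ q * ((m : ℝ) - (0 : ℕ)) ^ q)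
            + lam * C * δ ^ (p - q) * (δ ^ q * ((m : ℝ) - (0 : ℕ)) ^ q) := by rw [e5]; ring
        _ ≤ lam * ((2 * lam + 1) * C) * S * h ^ q + lam * C * δ ^ (p - q) * 1 := by
            rw [← e2]
            gcongr
            exact e3.trans e4
        _ = _ := by ring
    have e7 := mul_le_mul_of_nonneg_right hS.le_half'' hS0
    calc ‖z k - y k‖ ≤ S := hSle k le_rfl
      _ ≤ _ := by linarith
  · intro i hi
    have hih := ((mono hi).trans hk).trans hH
    rw [hφ.apply_self ha (nn i) hih (mem_closedBall_two _ (hym i hi)),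
      hφ.apply_self ha (nn i) hih (mem_closedBall_two _ (hze i hi).1)]
    simp
  · intro i hi
    have h1 : y (i + 1) = φ (i * δ) ((i + 1 : ℕ) * δ) (y i) := rfl
    have h2 : z (i + 1) = φ ((2 * i + 1 : ℕ) * (δ / 2)) ((i + 1 : ℕ) * δ)
        (φ (i * δ) ((2 * i + 1 : ℕ) * (δ / 2)) (z i)) := by
      rw [← two i, ← two (i + 1)]; rfl
    have h3 := hφ.defect (i * δ) ((2 * i + 1 : ℕ) * (δ / 2)) ((i + 1 : ℕ) * δ) (nn i)
      (by push_cast; linarith) (by push_cast; linarith) (((mono hi).trans hk).trans hH) (z i)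
      (hze i hi.le).1
    rw [← h1, ← h2, show ((i + 1 : ℕ) : ℝ) * δ - i * δ = δ by push_cast; ring] at *
    simp only [sub_self, sub_zero]
    refine h3.trans ?_
    have : 0 ≤ (2 * lam + 1) * C * S * δ ^ q := by positivity
    linarith
  · intro i j l hij hjl hl
    have hlh : (l : ℝ) * δ ≤ h := (mono hl).trans hk
    have hjh : (j : ℝ) * δ ≤ h := (mono hjl.le).trans hlh
    have hzi := (hze i (by omega)).1
    have hyi := hym i (by omega)
    have hzj := mem_closedBall_two _ (hze j (by omega)).1
    have hyj := mem_closedBall_two _ (hym j (by omega))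
    have hpz := hφ.map_mem ha hS hH (nn i) (mono hij.le) hjh hzi
    have hpy := hφ.map_mem ha hS hH (nn i) (mono hij.le) hjh hyi
    have h1 := hφ.four_point _ _ (nn j) (mono hjl.le) (hlh.trans hH) _ hzj _ hpz _ hyj _ hpy
    have h2 := hφ.defect_lipschitz _ _ _ (nn i) (mono hij.le) (mono hjl.le) (hlh.trans hH) _ hzi
      _ hyi
    have h3 := hφ.norm_map_sub_le ha hS hH (nn i) (mono hij.le) hjh (mem_closedBall_two _ hzi)
      (mem_closedBall_two _ hyi)
    have h4 := (hze j (by omega)).2 i hij.le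
    have h5 := mul_rpow_le hC ha (nn j) (mono hjl.le) hlh
    have h6 := mul_rpow_le' hC hqp hS.le_one (nn i) (mono (hij.trans hjl).le) hlh (by linarith)
    have h7 : ((j : ℝ) * δ - i * δ) ^ q ≤ (l * δ - i * δ) ^ q := by
      have := mono hij.le
      have := mono hjl.le
      gcongr
    have h8 := hS.le_half
    have h9 := hS.le_rho
    set A := z l - φ (j * δ) (l * δ) (z j)
    set A' := y l - φ (j * δ) (l * δ) (y j)
    set B := z j - φ (i * δ) (j * δ) (z i)
    set B' := y j - φ (i * δ) (j * δ) (y i)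
    set D := φ (j * δ) (l * δ) (φ (i * δ) (j * δ) (z i)) - φ (i * δ) (l * δ) (z i)
    set D' := φ (j * δ) (l * δ) (φ (i * δ) (j * δ) (y i)) - φ (i * δ) (l * δ) (y i)
    set G := φ (j * δ) (l * δ) (z j) - z j -
      (φ (j * δ) (l * δ) (φ (i * δ) (j * δ) (z i)) - φ (i * δ) (j * δ) (z i)) -
      (φ (j * δ) (l * δ) (y j) - y j -
      (φ (j * δ) (l * δ) (φ (i * δ) (j * δ) (y i)) - φ (i * δ) (j * δ) (y i)))
    have e1 : z l - φ (i * δ) (l * δ) (z i) - (y l - φ (i * δ) (l * δ) (y i)) =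
        (A - A') + (B - B') + G + (D - D') := by simp only [A, A', B, B', G, D, D']; abel
    have hX : 0 ≤ ((l : ℝ) * δ - i * δ) ^ q :=
      Real.rpow_nonneg (by linarith [mono (hij.trans hjl).le]) _
    -- The two distances in the four-point bound are at most `S` and `(3/2) S`, hence `4S` with room
    -- to spare; the factor `C h^a ≤ 1/2` then leaves `2λ`.
    have e2 : ‖G‖ ≤ C * h ^ a * ‖B - B'‖ + 2 * lam * C * S * (l * δ - i * δ) ^ q := by
      have f1 : (‖z j - y j‖ + ‖φ (i * δ) (j * δ) (z i) - φ (i * δ) (j * δ) (y i)‖) ≤ 4 * S := by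
        have g1 := hSle j (by omega)
        have g2 := hSle i (by omega)
        have g3 := mul_le_mul_of_nonneg_right h8 (norm_nonneg (z i - y i))
        linarith
      have f2 : ‖B‖ ≤ lam * C * (l * δ - i * δ) ^ q := h4.trans (by gcongr)
      have hnn : 0 ≤ C * h ^ a := mul_nonneg hC (Real.rpow_nonneg hS.pos.le _)
      calc ‖G‖ ≤ _ := h1
        _ ≤ C * h ^ a * (‖B - B'‖ + 4 * S * (lam * C * (l * δ - i * δ) ^ q)) := by gcongr
        _ = C * h ^ a * ‖B - B'‖ + C * h ^ a * (4 * S * (lam * C * (l * δ - i * δ) ^ q)) := by ring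
        _ ≤ C * h ^ a * ‖B - B'‖ + 1 / 2 * (4 * S * (lam * C * (l * δ - i * δ) ^ q)) := by gcongr
        _ = _ := by ring
    have e3 : ‖D - D'‖ ≤ C * S * (l * δ - i * δ) ^ q := by
      calc _ ≤ _ := h2
        _ ≤ C * (l * δ - i * δ) ^ q * S := by
          gcongr
          exact hSle i (by omega)
        _ = _ := by ring
    have e4 := mul_le_mul_of_nonneg_right h9 (norm_nonneg (B - B'))
    have e5 : ‖(A - A') + (B - B') + G + (D - D')‖ ≤ ‖A - A'‖ + ‖B - B'‖ + ‖G‖ + ‖D - D'‖ :=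
      norm_add₄_le
    have e6 := grid_rpow (q := q) hδ.le (hij.trans hjl).le
    have e7 : 0 ≤ C * δ ^ p * ((l : ℝ) - i) ^ q := by
      have : (i : ℝ) ≤ l := by exact_mod_cast (hij.trans hjl).le
      have := Real.rpow_nonneg (sub_nonneg.mpr this) q
      positivity
    have e8 : ((2 * lam + 1) * C * S * δ ^ q + C * δ ^ p) * ((l : ℝ) - i) ^ q =
        (2 * lam + 1) * C * S * (l * δ - i * δ) ^ q + C * δ ^ p * ((l : ℝ) - i) ^ q := by
      rw [e6]; ring
    rw [e1, e8]
    linarith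

end IsAlmostFlow
end AlmostFlow

/-! ### Limit along dyadic grids -/

namespace IsAlmostFlow

variable {E : Type*} [NormedAddCommGroup E]
variable {a p q H C ρ lam h : ℝ} {ξ : E} {φ : ℝ → ℝ → E → E}

/-- A fine grid point of odd index has no coarse counterpart; it is compared with its predecessor,
at the cost of one fine step. -/
theorem eulerScheme_refine (hφ : IsAlmostFlow a p H C ξ φ) (ha : 0 < a) (hq : 1 < q) (hqp : q ≤ p)
    (hS : ShortTime a q C ρ lam h) (hH : h ≤ H) (hsew : DiscreteSewing q ρ lam) (hlam : 1 < lam)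
    {δ : ℝ} (hδ : 0 < δ) (m : ℕ) (hm : m * (δ / 2) ≤ h) :
    ‖eulerScheme φ ξ (δ / 2) m - eulerScheme φ ξ δ (m / 2)‖ ≤
      2 * lam * C * δ ^ (p - q) + C * δ ^ a := by
  have hC := hφ.nonneg (hS.pos.trans_le hH)
  have h1 : ((m / 2 : ℕ) : ℝ) * δ ≤ m * (δ / 2) := by
    have : ((2 * (m / 2) : ℕ) : ℝ) ≤ m := by exact_mod_cast Nat.mul_div_le m 2
    push_cast at this
    nlinarith
  have h2 := hφ.eulerScheme_halve ha hq hqp hS hH hsew hlam hδ (m / 2) (h1.trans hm)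
  have h3 : 0 ≤ C * δ ^ a := by positivity
  rcases Nat.even_or_odd' m with ⟨i, rfl | rfl⟩
  · rw [Nat.mul_div_cancel_left _ two_pos] at *
    linarith
  · rw [show (2 * i + 1) / 2 = i by omega] at *
    have h4 : eulerScheme φ ξ (δ / 2) (2 * i + 1) = φ ((2 * i : ℕ) * (δ / 2))
      ((2 * i + 1 : ℕ) * (δ / 2)) (eulerScheme φ ξ (δ / 2) (2 * i)) := rfl
    have hle : ((2 * i : ℕ) : ℝ) * (δ / 2) ≤ (2 * i + 1 : ℕ) * (δ / 2) := by push_cast; linarith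
    have h5 := (hφ.eulerScheme_estimate ha hq hqp hS hH hsew hlam (half_pos hδ) (2 * i)
      (hle.trans hm)).1
    have h6 := hφ.norm_sub_le _ _ (by positivity) hle (hm.trans hH) _ (mem_closedBall_two _ h5)
    have h7 : (((2 * i + 1 : ℕ) : ℝ) * (δ / 2) - (2 * i : ℕ) * (δ / 2)) ^ a ≤ δ ^ a := by
      rw [show ((2 * i + 1 : ℕ) : ℝ) * (δ / 2) - (2 * i : ℕ) * (δ / 2) = δ / 2 by push_cast; ring]
      gcongr
      linarith
    have h8 := mul_le_mul_of_nonneg_left h7 hC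
    rw [h4, ← sub_add_sub_cancel _ (eulerScheme φ ξ (δ / 2) (2 * i))]
    exact (norm_add_le _ _).trans (by linarith)

/-- A path that follows an almost flow. -/
theorem exists_path [CompleteSpace E] (hφ : IsAlmostFlow a p H C ξ φ) (ha : 0 < a) (hq : 1 < q)
    (hqp : q < p) (hH : 0 < H) :
    ∃ h, 0 < h ∧ h ≤ H ∧ ∃ (K : ℝ) (Y : ℝ → E), 0 ≤ K ∧ Y 0 = ξ ∧
      (∀ t ∈ Icc 0 h, Y t ∈ Metric.closedBall ξ 1) ∧
      ∀ s t, 0 ≤ s → s ≤ t → t ≤ h → ‖Y t - φ s t (Y s)‖ ≤ K * (t - s) ^ q := by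
  obtain ⟨ρ, hρ, lam, hlam, hsew⟩ := exists_discrete_sewing hq
  obtain ⟨h, hhH, hS⟩ := exists_shortTime (C := C) (lam := lam) ha (by linarith : 0 < q) hρ hH
  have hC := hφ.nonneg hH
  have hpos := hS.pos
  set δ : ℕ → ℝ := fun n => h / 2 ^ n with hδdef
  have hδ : ∀ n, 0 < δ n := fun n => by positivity
  have hδ' : ∀ n, δ (n + 1) = δ n / 2 := fun n => by simp only [δ, pow_succ]; field_simp
  have hδ0 : Filter.Tendsto δ Filter.atTop (nhds 0) := by
    have := (tendsto_pow_atTop_nhds_zero_of_lt_one (r := (1 / 2 : ℝ)) (by norm_num)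
      (by norm_num)).const_mul h
    simpa [δ, div_eq_mul_inv] using this
  set idx : ℕ → ℝ → ℕ := fun n t => ⌊t / δ n⌋₊ with hidx
  have idx_le : ∀ n t, 0 ≤ t → idx n t * δ n ≤ t := fun n t ht =>
    (le_div_iff₀ (hδ n)).mp (Nat.floor_le (div_nonneg ht (hδ n).le))
  have lt_idx : ∀ n t, t < idx n t * δ n + δ n := fun n t => by
    have := (div_lt_iff₀ (hδ n)).mp (Nat.lt_floor_add_one (t / δ n))
    linarith
  have idx_succ : ∀ n t, idx n t = idx (n + 1) t / 2 := fun n t => by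
    have : t / δ n = t / δ (n + 1) / (2 : ℕ) := by
      rw [hδ']; have := (hδ n).ne'; push_cast; field_simp
    simp only [idx]
    rw [this, Nat.floor_div_natCast]
  set y : ℕ → ℝ → E := fun n t => eulerScheme φ ξ (δ n) (idx n t) with hy
  have hest := fun n t (ht : t ∈ Icc 0 h) => hφ.eulerScheme_estimate ha hq hqp.le hS hhH hsew hlam
    (hδ n) (idx n t) ((idx_le n t ht.1).trans ht.2)
  have hstep : ∀ t ∈ Icc 0 h, ∀ n, dist (y n t) (y (n + 1) t) ≤
      (2 * lam * C + C) * ((1 / 2 : ℝ) ^ min (p - q) a) ^ n := by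
    intro t ht n
    rw [dist_comm, dist_eq_norm]
    have := hφ.eulerScheme_refine ha hq hqp.le hS hhH hsew hlam (hδ n) (idx (n + 1) t)
      (by rw [← hδ']; exact (idx_le _ t ht.1).trans ht.2)
    rw [← hδ', ← idx_succ] at this
    have hd : ∀ b, min (p - q) a ≤ b → (δ n) ^ b ≤ ((1 / 2 : ℝ) ^ min (p - q) a) ^ n := by
      intro b hb
      have hδn : δ n ≤ (1 / 2) ^ n := by
        simp only [δ, div_eq_mul_inv, one_mul, inv_pow]
        exact mul_le_of_le_one_left (by positivity) hS.le_one
      have hδ1 : δ n ≤ 1 := hδn.trans (pow_le_one₀ (by norm_num) (by norm_num))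
      have hm0 : 0 ≤ min (p - q) a := le_min (by linarith) ha.le
      calc (δ n) ^ b ≤ (δ n) ^ min (p - q) a :=
            Real.rpow_le_rpow_of_exponent_ge (hδ n) hδ1 hb
        _ ≤ ((1 / 2 : ℝ) ^ n) ^ min (p - q) a := Real.rpow_le_rpow (hδ n).le hδn hm0
        _ = _ := by
          rw [← Real.rpow_natCast, ← Real.rpow_natCast, ← Real.rpow_mul (by norm_num),
            ← Real.rpow_mul (by norm_num), mul_comm]
    calc _ ≤ _ := this
      _ ≤ 2 * lam * C * ((1 / 2 : ℝ) ^ min (p - q) a) ^ n +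
          C * ((1 / 2 : ℝ) ^ min (p - q) a) ^ n := by
        gcongr
        · exact hd _ (min_le_left _ _)
        · exact hd _ (min_le_right _ _)
      _ = _ := by ring
  have hr : (1 / 2 : ℝ) ^ min (p - q) a < 1 :=
    Real.rpow_lt_one (by norm_num) (by norm_num) (lt_min (by linarith) ha)
  -- Off `[0, h]` the value is an irrelevant default.
  have hlim : ∀ t, ∃ Yt, t ∈ Icc 0 h → Filter.Tendsto (fun n => y n t) Filter.atTop (nhds Yt) := by
    intro t
    by_cases ht : t ∈ Icc 0 h
    · obtain ⟨Yt, hYt⟩ := cauchySeq_tendsto_of_complete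
        (cauchySeq_of_le_geometric _ _ hr (hstep t ht))
      exact ⟨Yt, fun _ => hYt⟩
    · exact ⟨0, fun h => absurd h ht⟩
  choose Y hY using hlim
  have hball : ∀ t ∈ Icc 0 h, Y t ∈ Metric.closedBall ξ 1 := fun t ht =>
    Metric.isClosed_closedBall.mem_of_tendsto (hY t ht)
      (Filter.Eventually.of_forall fun n => (hest n t ht).1)
  refine ⟨h, hpos, hhH, lam * C, Y, by positivity, ?_, hball, ?_⟩
  · refine tendsto_nhds_unique (hY 0 ⟨le_rfl, hpos.le⟩) ?_
    have : ∀ n, y n 0 = ξ := fun n => by simp [y, idx, eulerScheme]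
    simp only [this]
    exact tendsto_const_nhds
  intro s t hs hst ht
  have hs' : s ∈ Icc 0 h := ⟨hs, hst.trans ht⟩
  have ht' : t ∈ Icc 0 h := ⟨hs.trans hst, ht⟩
  -- The three terms come from the scheme estimate between the grid points just below `s` and `t`,
  -- from replacing `y n s` by `Y s`, and from moving the grid times to `s` and `t`. Only the first
  -- survives as `n → ∞`.
  have bound : ∀ n, ‖y n t - φ s t (Y s)‖ ≤ lam * C * (t - s + δ n) ^ q
      + 2 * ‖y n s - Y s‖ + C * ((δ n) ^ a + (δ n) ^ a) := by
    intro n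
    have hsn := idx_le n s hs
    have htn := idx_le n t ht'.1
    have hidx_le : idx n s ≤ idx n t := Nat.floor_le_floor (by have := hδ n; gcongr)
    have hle : idx n s * δ n ≤ idx n t * δ n := by have := hδ n; gcongr
    have hs0 : 0 ≤ idx n s * δ n := by have := hδ n; positivity
    have h1 := (hest n t ht').2 _ hidx_le
    have h2 := hφ.norm_map_sub_le ha hS hhH hs0 hle (htn.trans ht)
      (mem_closedBall_two _ (hest n s hs').1) (mem_closedBall_two _ (hball s hs'))
    have h3 := hφ.time_holder s (idx n s * δ n) t (idx n t * δ n) hs0 hsn htn hst hle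
      (ht.trans hhH) _ (hball s hs')
    have h4 : (idx n t * δ n - idx n s * δ n) ^ q ≤ (t - s + δ n) ^ q := by
      apply Real.rpow_le_rpow (by linarith) _ (by linarith)
      linarith [lt_idx n s]
    have h5 : (s - idx n s * δ n) ^ a ≤ (δ n) ^ a :=
      Real.rpow_le_rpow (by linarith) (by linarith [lt_idx n s]) ha.le
    have h6 : (t - idx n t * δ n) ^ a ≤ (δ n) ^ a :=
      Real.rpow_le_rpow (by linarith) (by linarith [lt_idx n t]) ha.le
    have h7 := mul_le_mul_of_nonneg_left h4 (by positivity : 0 ≤ lam * C)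
    have h8 := mul_le_mul_of_nonneg_left (add_le_add h5 h6) hC
    have h9 := mul_le_mul_of_nonneg_right hS.le_half (norm_nonneg (y n s - Y s))
    have e : y n t - φ s t (Y s) =
      (y n t - φ (idx n s * δ n) (idx n t * δ n) (y n s)) +
      (φ (idx n s * δ n) (idx n t * δ n) (y n s) - φ (idx n s * δ n) (idx n t * δ n) (Y s)) +
      (φ (idx n s * δ n) (idx n t * δ n) (Y s) - φ s t (Y s)) := by abel
    rw [e]
    refine norm_add₃_le.trans ?_
    have h10 := norm_nonneg (y n s - Y s)
    exact add_le_add (add_le_add (h1.trans h7) (h2.trans (by linarith))) (h3.trans h8)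
  have hp : ∀ b c : ℝ, 0 < b → Filter.Tendsto (fun n => (c + δ n) ^ b) Filter.atTop
      (nhds (c ^ b)) := fun b c hb => by
    have h1 : Filter.Tendsto (fun n => c + δ n) Filter.atTop (nhds c) := by
      simpa using hδ0.const_add c
    exact h1.rpow_const (Or.inr hb.le)
  have hpa : Filter.Tendsto (fun n => (δ n) ^ a) Filter.atTop (nhds 0) := by
    simpa [Real.zero_rpow ha.ne'] using hp a 0 ha
  have hns : Filter.Tendsto (fun n => ‖y n s - Y s‖) Filter.atTop (nhds 0) :=
    tendsto_iff_norm_sub_tendsto_zero.mp (hY s hs')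
  have hR := (((hp q (t - s) (by linarith)).const_mul (lam * C)).add (hns.const_mul 2)).add
    ((hpa.add hpa).const_mul C)
  simp only [mul_zero, add_zero] at hR
  exact le_of_tendsto_of_tendsto' ((hY t ht').sub_const _).norm hR bound

end IsAlmostFlow

/-! ### The composition defect of one-step maps -/

section Calculus

variable {E : Type*} [NormedAddCommGroup E] [NormedSpace ℝ E]

/-- On `S`, the function `f` is of class `C^{2,1}` with constant `c`, and `q` is of class `C^{1,1}`
with constant `d`. -/
structure LocalBounds (S : Set E) (c d : ℝ) (f q : E → E) : Prop where
  diff : Differentiable ℝ f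
  diff_fderiv : Differentiable ℝ (fderiv ℝ f)
  diff_second : Differentiable ℝ q
  norm_le : ∀ x ∈ S, ‖f x‖ ≤ c
  norm_fderiv_le : ∀ x ∈ S, ‖fderiv ℝ f x‖ ≤ c
  norm_fderiv_fderiv_le : ∀ x ∈ S, ‖fderiv ℝ (fderiv ℝ f) x‖ ≤ c
  lipschitz : ∀ x ∈ S, ∀ y ∈ S,
    ‖fderiv ℝ (fderiv ℝ f) x - fderiv ℝ (fderiv ℝ f) y‖ ≤ c * ‖x - y‖
  norm_second_le : ∀ x ∈ S, ‖q x‖ ≤ d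
  norm_fderiv_second_le : ∀ x ∈ S, ‖fderiv ℝ q x‖ ≤ d
  lipschitz_second : ∀ x ∈ S, ∀ y ∈ S, ‖fderiv ℝ q x - fderiv ℝ q y‖ ≤ d * ‖x - y‖

namespace LocalBounds

variable {S : Set E} {c d c' d' : ℝ} {f q w g : E → E}

theorem mono (h : LocalBounds S c d f q) (hc : c ≤ c') (hd : d ≤ d') :
    LocalBounds S c' d' f q where
  diff := h.diff
  diff_fderiv := h.diff_fderiv
  diff_second := h.diff_second
  norm_le x hx := (h.norm_le x hx).trans hc
  norm_fderiv_le x hx := (h.norm_fderiv_le x hx).trans hc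
  norm_fderiv_fderiv_le x hx := (h.norm_fderiv_fderiv_le x hx).trans hc
  lipschitz x hx y hy := (h.lipschitz x hx y hy).trans (by gcongr)
  norm_second_le x hx := (h.norm_second_le x hx).trans hd
  norm_fderiv_second_le x hx := (h.norm_fderiv_second_le x hx).trans hd
  lipschitz_second x hx y hy := (h.lipschitz_second x hx y hy).trans (by gcongr)

theorem fderiv_lipschitz (h : LocalBounds S c d f q) (hS : Convex ℝ S) {x y : E} (hx : x ∈ S)
    (hy : y ∈ S) : ‖fderiv ℝ f x - fderiv ℝ f y‖ ≤ c * ‖x - y‖ :=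
  hS.norm_image_sub_le_of_norm_fderiv_le (fun z _ => h.diff_fderiv z) h.norm_fderiv_fderiv_le hy hx

theorem second_lipschitz (h : LocalBounds S c d f q) (hS : Convex ℝ S) {x y : E} (hx : x ∈ S)
    (hy : y ∈ S) : ‖q x - q y‖ ≤ d * ‖x - y‖ :=
  hS.norm_image_sub_le_of_norm_fderiv_le (fun z _ => h.diff_second z) h.norm_fderiv_second_le hy hx

theorem norm_fderiv_add_le (h : LocalBounds S c d f q) {x : E} (hx : x ∈ S) :
    ‖fderiv ℝ f x + fderiv ℝ q x‖ ≤ c + d :=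
  (norm_add_le _ _).trans (add_le_add (h.norm_fderiv_le x hx) (h.norm_fderiv_second_le x hx))

theorem norm_add_le (h : LocalBounds S c d f q) {x : E} (hx : x ∈ S) : ‖f x + q x‖ ≤ c + d :=
  (_root_.norm_add_le _ _).trans (add_le_add (h.norm_le x hx) (h.norm_second_le x hx))

theorem add_lipschitz (h : LocalBounds S c d f q) (hS : Convex ℝ S) {x y : E} (hx : x ∈ S)
    (hy : y ∈ S) : ‖f x + q x - (f y + q y)‖ ≤ (c + d) * ‖x - y‖ :=
  hS.norm_image_sub_le_of_norm_hasFDerivWithin_le (f := fun x => f x + q x)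
    (fun z _ => ((h.diff z).hasFDerivAt.add (h.diff_second z).hasFDerivAt).hasFDerivWithinAt)
    (fun _ hz => h.norm_fderiv_add_le hz) hy hx

theorem add_four_point (h : LocalBounds S c d f q) (hS : Convex ℝ S) {x x' y y' : E}
    (hx : x ∈ S) (hx' : x' ∈ S) (hy : y ∈ S) (hy' : y' ∈ S) :
    ‖f x + q x - (f x' + q x') - (f y + q y - (f y' + q y'))‖ ≤
      (c + d) * (‖x - x' - (y - y')‖ + (‖x - y‖ + ‖x' - y'‖) * ‖x - x'‖) := by
  refine hS.norm_four_point_le (G := fun x => f x + q x)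
    (fun z _ => (h.diff z).hasFDerivAt.add (h.diff_second z).hasFDerivAt)
    (fun _ hz => h.norm_fderiv_add_le hz) (fun x hx y hy => ?_) hx hx' hy hy'
  calc ‖fderiv ℝ f x + fderiv ℝ q x - (fderiv ℝ f y + fderiv ℝ q y)‖
      = ‖(fderiv ℝ f x - fderiv ℝ f y) + (fderiv ℝ q x - fderiv ℝ q y)‖ := by congr 1; abel
    _ ≤ c * ‖x - y‖ + d * ‖x - y‖ := (_root_.norm_add_le _ _).trans
        (add_le_add (h.fderiv_lipschitz hS hx hy) (h.lipschitz_second x hx y hy))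
    _ = _ := by ring

/-- The difference between a composition of two one-step maps and the one-step map over the union
of the two steps. -/
noncomputable def defect (w q f g : E → E) (x : E) : E :=
  f (x + w x + q x) - f x - fderiv ℝ f x (w x) + (g (x + w x + q x) - g x)

variable (h₁ : LocalBounds S c d w q) (h₂ : LocalBounds S c d f g) (hS : Convex ℝ S)

include h₁ in
theorem norm_step_sub_le {x : E} (hx : x ∈ S) : ‖x + w x + q x - x‖ ≤ c + d := by
  rw [show x + w x + q x - x = w x + q x by abel]
  exact h₁.norm_add_le hx

include h₁ h₂ hS in
-- The defect is a Taylor remainder of `f` along `w x + q x`, plus `fderiv ℝ f x (q x)`, plus an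
-- increment of `g`. When `c` is of order `e` and `d` of order `e²`, with `e` small, all three are
-- of order `e³`.
theorem norm_defect_le {x : E} (hx : x ∈ S) (hz : x + w x + q x ∈ S) :
    ‖defect w q f g x‖ ≤ c * (c + d) * (c + d) + c * d + d * (c + d) := by
  have hc : 0 ≤ c := (norm_nonneg _).trans (h₁.norm_le x hx)
  have hd : 0 ≤ d := (norm_nonneg _).trans (h₁.norm_second_le x hx)
  have hr := h₁.norm_step_sub_le hx
  set z := x + w x + q x with hzdef
  have e : defect w q f g x =
      (f z - f x - fderiv ℝ f x (z - x)) + fderiv ℝ f x (q x) + (g z - g x) := by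
    have : z - x = w x + q x := by rw [hzdef]; abel
    rw [this, map_add, defect]; abel
  have h1 := hS.norm_taylor_le hc (fun y _ => (h₂.diff y).hasFDerivAt)
    (fun x hx y hy => h₂.fderiv_lipschitz hS hx hy) hx hz
  rw [e]
  refine norm_add₃_le.trans (add_le_add (add_le_add (h1.trans ?_) ?_) ?_)
  · gcongr
  · exact (ContinuousLinearMap.le_opNorm _ _).trans (mul_le_mul (h₂.norm_fderiv_le x hx)
      (h₁.norm_second_le x hx) (norm_nonneg _) hc)
  · exact (h₂.second_lipschitz hS hz hx).trans (by gcongr)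

include h₁ h₂ hS in
theorem defect_hasFDerivAt {x : E} (hx : x ∈ S) (hz : x + w x + q x ∈ S) :
    ∃ D : E →L[ℝ] E, HasFDerivAt (defect w q f g) D x ∧
      ‖D‖ ≤ c * (c + d) * (c + d) + 2 * (c * d) + c * (c + d) * c + 2 * (d * (c + d)) := by
  have hc : 0 ≤ c := (norm_nonneg _).trans (h₁.norm_le x hx)
  have hd : 0 ≤ d := (norm_nonneg _).trans (h₁.norm_second_le x hx)
  have hr := h₁.norm_step_sub_le hx
  have hzd : HasFDerivAt (fun x => x + w x + q x)
      (ContinuousLinearMap.id ℝ E + fderiv ℝ w x + fderiv ℝ q x) x :=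
    ((hasFDerivAt_id x).add (h₁.diff x).hasFDerivAt).add (h₁.diff_second x).hasFDerivAt
  have hD := ((((h₂.diff (x + w x + q x)).hasFDerivAt.comp x hzd).sub
    (h₂.diff x).hasFDerivAt).sub
    ((h₂.diff_fderiv x).hasFDerivAt.clm_apply (h₁.diff x).hasFDerivAt)).add
    (((h₂.diff_second (x + w x + q x)).hasFDerivAt.comp x hzd).sub (h₂.diff_second x).hasFDerivAt)
  refine ⟨_, hD, ContinuousLinearMap.opNorm_le_bound _ (by positivity) fun v => ?_⟩
  -- Differentiating `fderiv ℝ f x (w x)` in the direction `v` gives `D²f(x)(v, w x)`, while the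
  -- expansion of `fderiv ℝ f` along `w x` gives `D²f(x)(w x, v)`. Symmetry cancels these
  -- second-order terms and leaves third-order ones.
  have hsymm : fderiv ℝ (fderiv ℝ f) x v (w x) = fderiv ℝ (fderiv ℝ f) x (w x) v :=
    second_derivative_symmetric (fun y => (h₂.diff y).hasFDerivAt)
      (h₂.diff_fderiv x).hasFDerivAt v (w x)
  set z := x + w x + q x with hzdef
  set f2 := fderiv ℝ (fderiv ℝ f) x
  have hzx : z - x = w x + q x := by rw [hzdef]; abel
  have h1 : ‖fderiv ℝ f z - fderiv ℝ f x - f2 (z - x)‖ ≤ c * (c + d) * (c + d) :=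
    (hS.norm_taylor_le hc (fun y _ => (h₂.diff_fderiv y).hasFDerivAt) h₂.lipschitz hx hz).trans
      (by gcongr)
  have h2 : ‖f2 (q x)‖ ≤ c * d := (ContinuousLinearMap.le_opNorm _ _).trans
    (mul_le_mul (h₂.norm_fderiv_fderiv_le x hx) (h₁.norm_second_le x hx) (norm_nonneg _) hc)
  have h3 : ‖fderiv ℝ f z - fderiv ℝ f x‖ ≤ c * (c + d) :=
    (h₂.fderiv_lipschitz hS hz hx).trans (by gcongr)
  have h4 : ‖fderiv ℝ g z - fderiv ℝ g x‖ ≤ d * (c + d) :=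
    (h₂.lipschitz_second z hz x hx).trans (by gcongr)
  have ap : ∀ {L : E →L[ℝ] E} {b : ℝ} {u : E} {m : ℝ}, ‖L‖ ≤ b → ‖u‖ ≤ m → 0 ≤ b →
      ‖L u‖ ≤ b * m := fun hL hu hb =>
    (ContinuousLinearMap.le_opNorm _ _).trans (mul_le_mul hL hu (norm_nonneg _) hb)
  have hv := le_refl ‖v‖
  have a1 := ap h1 hv (by positivity)
  have a2 := ap h2 hv (by positivity)
  have a3 := ap h3 (ap (h₁.norm_fderiv_le x hx) hv hc) (by positivity)
  have a4 := ap (h₂.norm_fderiv_le z hz) (ap (h₁.norm_fderiv_second_le x hx) hv hd) hc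
  have a5 := ap h4 hv (by positivity)
  have a6 := ap (h₂.norm_fderiv_second_le z hz) (ap (h₁.norm_fderiv_add_le hx) hv (by positivity)) hd
  have e : ∀ D : E →L[ℝ] E, D = (((fderiv ℝ f z).comp
        (ContinuousLinearMap.id ℝ E + fderiv ℝ w x + fderiv ℝ q x) - fderiv ℝ f x) -
        ((fderiv ℝ f x).comp (fderiv ℝ w x) + f2.flip (w x)) +
        ((fderiv ℝ g z).comp (ContinuousLinearMap.id ℝ E + fderiv ℝ w x + fderiv ℝ q x)
          - fderiv ℝ g x)) → D v =
      (fderiv ℝ f z - fderiv ℝ f x - f2 (z - x)) v + f2 (q x) v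
      + (fderiv ℝ f z - fderiv ℝ f x) (fderiv ℝ w x v) + fderiv ℝ f z (fderiv ℝ q x v)
      + (fderiv ℝ g z - fderiv ℝ g x) v + fderiv ℝ g z ((fderiv ℝ w x + fderiv ℝ q x) v) := by
    rintro D rfl
    rw [hzx]
    simp only [_root_.sub_apply, _root_.add_apply, ContinuousLinearMap.comp_apply, map_add,
      ContinuousLinearMap.flip_apply, ContinuousLinearMap.id_apply, hsymm]
    abel
  rw [e _ rfl]
  calc _ ≤ _ := norm_add_le_of_le (norm_add_le_of_le (norm_add_le_of_le
          (norm_add_le_of_le (norm_add_le_of_le a1 a2) a3) a4) a5) a6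
    _ = _ := by ring

end LocalBounds

end Calculus

/-! ### Local bounds for a nonlinear rough path -/

section RoughPath

theorem TimesDifferentiable.differentiable {E F : Type*} [NormedAddCommGroup E] [NormedSpace ℝ E]
    [NormedAddCommGroup F] [NormedSpace ℝ F] {n : ℕ} {f : E → F}
    (h : TimesDifferentiable (n + 1) f) : Differentiable ℝ f := by
  have := h 0 (Nat.succ_pos n)
  rwa [iteratedFDeriv_zero_eq_comp, LinearIsometryEquiv.comp_differentiable_iff] at this

theorem TimesDifferentiable.fderiv {E F : Type*} [NormedAddCommGroup E] [NormedSpace ℝ E]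
    [NormedAddCommGroup F] [NormedSpace ℝ F] {n : ℕ} {f : E → F}
    (h : TimesDifferentiable (n + 1) f) : TimesDifferentiable n (fderiv ℝ f) := by
  intro k hk
  have := h (k + 1) (by omega)
  rw [show iteratedFDeriv ℝ (k + 1) f = _ from
    funext fun x => iteratedFDeriv_succ_eq_comp_right] at this
  exact (continuousMultilinearCurryRightEquiv' ℝ k E F).symm.comp_differentiable_iff.mp this

variable {V K : Type*} [NormedAddCommGroup V] [NormedSpace ℝ V]
  [NormedAddCommGroup K] [NormedSpace ℝ K]

@[simp] theorem incr_self {E : Type*} [AddCommGroup E] (Φ : ℝ → E) (s : ℝ) : incr Φ s s = 0 :=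
  sub_self _

theorem norm_iteratedFDeriv_incr_le {α T : ℝ} {n : ℕ} {β : ℕ → ℝ} {Φ : ℝ → V → K}
    (h : growthSeminorm α T n β Φ < ∞) {k : ℕ} (hk : k ≤ n) {s t : ℝ} (hs : s ∈ Icc 0 T)
    (ht : t ∈ Icc 0 T) (x : V) :
    ‖iteratedFDeriv ℝ k (incr Φ s t) x‖ ≤
      (growthSeminorm α T n β Φ).toReal * (|t - s| ^ α * (1 + ‖x‖) ^ β k) := by
  rcases eq_or_ne s t with rfl | hst
  · rw [incr_self, show (0 : V → K) = fun _ => 0 from rfl, iteratedFDeriv_fun_zero]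
    simp only [Pi.zero_apply, norm_zero]
    positivity
  · have hpos : 0 < |t - s| ^ α * (1 + ‖x‖) ^ β k := by
      have : 0 < |t - s| := abs_pos.mpr (sub_ne_zero.mpr hst.symm)
      positivity
    rw [← div_le_iff₀ hpos, ← ENNReal.ofReal_le_iff_le_toReal h.ne, growthSeminorm]
    refine le_trans ?_ (Finset.single_le_sum (fun _ _ => zero_le)
      (Finset.mem_range.mpr (Nat.lt_succ_of_le hk)))
    exact le_iSup_of_le s (le_iSup_of_le hs (le_iSup_of_le t (le_iSup_of_le ht
      (le_iSup_of_le hst (le_iSup_of_le x le_rfl)))))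

theorem norm_iteratedFDeriv_two_le {α T : ℝ} {n : ℕ} {β₁ β₂ : ℕ → ℝ}
    {Ψ : ℝ → ℝ → WithLp 1 (V × V) → K}
    (h : growthSeminormTwo α T n β₁ β₂ Ψ < ∞) {k : ℕ} (hk : k ≤ n) {s t : ℝ} (hs : s ∈ Icc 0 T)
    (ht : t ∈ Icc 0 T) (hst : s ≠ t) (x : WithLp 1 (V × V)) :
    ‖iteratedFDeriv ℝ k (Ψ s t) x‖ ≤ (growthSeminormTwo α T n β₁ β₂ Ψ).toReal *
      (|t - s| ^ α * (1 + ‖x.fst‖) ^ β₁ k * (1 + ‖x.snd‖) ^ β₂ k) := by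
  have hpos : 0 < |t - s| ^ α * (1 + ‖x.fst‖) ^ β₁ k * (1 + ‖x.snd‖) ^ β₂ k := by
    have : 0 < |t - s| := abs_pos.mpr (sub_ne_zero.mpr hst.symm)
    positivity
  rw [← div_le_iff₀ hpos, ← ENNReal.ofReal_le_iff_le_toReal h.ne, growthSeminormTwo]
  refine le_trans ?_ (Finset.single_le_sum (fun _ _ => zero_le)
    (Finset.mem_range.mpr (Nat.lt_succ_of_le hk)))
  exact le_iSup_of_le s (le_iSup_of_le hs (le_iSup_of_le t (le_iSup_of_le ht
    (le_iSup_of_le hst (le_iSup_of_le x le_rfl)))))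

/-- The diagonal map `x ↦ (x, x)`. -/
noncomputable def diagL (V : Type*) [NormedAddCommGroup V] [NormedSpace ℝ V] :
    V →L[ℝ] WithLp 1 (V × V) :=
  (WithLp.prodContinuousLinearEquiv 1 ℝ V V).symm.toContinuousLinearMap.comp
    ((ContinuousLinearMap.id ℝ V).prod (ContinuousLinearMap.id ℝ V))

theorem diagL_apply (x : V) : diagL V x = WithLp.toLp 1 (x, x) := rfl

theorem norm_diagL_le : ‖diagL V‖ ≤ 2 := by
  refine ContinuousLinearMap.opNorm_le_bound _ two_pos.le fun x => ?_
  rw [diagL_apply, WithLp.prod_norm_eq_of_L1]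
  exact (two_mul ‖x‖).ge

namespace IsNonlinearRoughPath

variable {α T : ℝ} {β : ℕ → ℝ} {W : ℝ → V → V} {WW : ℝ → ℝ → WithLp 1 (V × V) → V}

/-- The seminorm of `WW` ignores `s = t`; Chen's relation with three equal times controls that case.
-/
theorem second_self (hW : IsNonlinearRoughPath α T 3 β W WW) {s : ℝ} (hs : s ∈ Icc 0 T) :
    WW s s = 0 := by
  funext x
  have := hW.chen s hs s hs s hs x.fst x.snd
  simp only [incr_self, Pi.zero_apply, map_zero, sub_self, zero_sub, neg_eq_zero] at this
  exact this

theorem norm_incr_le (hW : IsNonlinearRoughPath α T 3 β W WW) {s t : ℝ} (hs : s ∈ Icc 0 T)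
    (ht : t ∈ Icc 0 T) (x : V) :
    ‖incr W s t x‖ ≤ roughPathNorm α T 3 β W WW * (|t - s| ^ α * (1 + ‖x‖) ^ β 0) := by
  have := norm_iteratedFDeriv_incr_le hW.mem_first.2 (Nat.zero_le 3) hs ht x
  rw [norm_iteratedFDeriv_zero] at this
  refine this.trans ?_
  gcongr
  rw [roughPathNorm]
  exact ENNReal.toReal_mono (ENNReal.add_lt_top.mpr ⟨hW.mem_first.2, hW.mem_second.2⟩).ne
    le_self_add

theorem norm_second_le (hW : IsNonlinearRoughPath α T 3 β W WW) {s t : ℝ} (hs : s ∈ Icc 0 T)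
    (ht : t ∈ Icc 0 T) (x : WithLp 1 (V × V)) :
    ‖WW s t x‖ ≤ roughPathNorm α T 3 β W WW * (|t - s| ^ (2 * α) * (1 + ‖x.fst‖) ^ betaStar β 0
      * (1 + ‖x.snd‖) ^ betaStarStar β 0) := by
  have hN : 0 ≤ roughPathNorm α T 3 β W WW := ENNReal.toReal_nonneg
  rcases eq_or_ne s t with rfl | hst
  · rw [hW.second_self hs, Pi.zero_apply, norm_zero]
    positivity
  have := norm_iteratedFDeriv_two_le hW.mem_second.2 (Nat.zero_le 2) hs ht hst x
  rw [norm_iteratedFDeriv_zero] at this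
  refine this.trans ?_
  gcongr
  rw [roughPathNorm]
  exact ENNReal.toReal_mono (ENNReal.add_lt_top.mpr ⟨hW.mem_first.2, hW.mem_second.2⟩).ne
    le_add_self

theorem exists_localBounds (hW : IsNonlinearRoughPath α T 3 β W WW) (ξ : V) :
    ∃ M ≥ (1 : ℝ), ∀ s ∈ Icc 0 T, ∀ t ∈ Icc 0 T,
      LocalBounds (Metric.closedBall ξ 2) (M * |t - s| ^ α) (M * |t - s| ^ (2 * α))
        (incr W s t) (fun x => WW s t (WithLp.toLp 1 (x, x))) := by
  set R : ℝ := 1 + (‖ξ‖ + 2) with hR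
  -- A single nonnegative exponent dominating all those in play, so that every growth weight on the
  -- ball is at most `R ^ b`.
  set b : ℝ := |β 0| + |β 1| + |β 2| + |β 3| +
    (|betaStar β 0| + |betaStar β 1| + |betaStar β 2|) +
    (|betaStarStar β 0| + |betaStarStar β 1| + |betaStarStar β 2|) with hb
  have hR1 : 1 ≤ R := by have := norm_nonneg ξ; linarith
  have hpow : ∀ c ≤ b, ∀ x ∈ Metric.closedBall ξ 2, (1 + ‖x‖) ^ c ≤ R ^ b := by
    intro c hc x hx
    have hx' : ‖x‖ ≤ ‖ξ‖ + 2 := norm_le_of_mem_closedBall hx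
    calc (1 + ‖x‖) ^ c ≤ (1 + ‖x‖) ^ b :=
          Real.rpow_le_rpow_of_exponent_le (by linarith [norm_nonneg x]) hc
      _ ≤ R ^ b := Real.rpow_le_rpow (by positivity) (by linarith) (by positivity)
  have hle : ∀ k ≤ 3, β k ≤ b := by
    intro k hk
    interval_cases k <;> rw [hb] <;>
    linarith [abs_nonneg (β 0), abs_nonneg (β 1), abs_nonneg (β 2), abs_nonneg (β 3),
      abs_nonneg (betaStar β 0), abs_nonneg (betaStar β 1), abs_nonneg (betaStar β 2),
      abs_nonneg (betaStarStar β 0), abs_nonneg (betaStarStar β 1), abs_nonneg (betaStarStar β 2),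
      le_abs_self (β 0), le_abs_self (β 1), le_abs_self (β 2), le_abs_self (β 3)]
  have hle' : ∀ k ≤ 2, betaStar β k ≤ b ∧ betaStarStar β k ≤ b := by
    intro k hk
    interval_cases k <;> rw [hb] <;> constructor <;>
    linarith [abs_nonneg (β 0), abs_nonneg (β 1), abs_nonneg (β 2), abs_nonneg (β 3),
      abs_nonneg (betaStar β 0), abs_nonneg (betaStar β 1), abs_nonneg (betaStar β 2),
      abs_nonneg (betaStarStar β 0), abs_nonneg (betaStarStar β 1), abs_nonneg (betaStarStar β 2),
      le_abs_self (betaStar β 0), le_abs_self (betaStar β 1), le_abs_self (betaStar β 2),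
      le_abs_self (betaStarStar β 0), le_abs_self (betaStarStar β 1),
      le_abs_self (betaStarStar β 2)]
  set N₁ := (growthSeminorm α T 3 β W).toReal with hN₁
  set N₂ := (growthSeminormTwo (2 * α) T (3 - 1) (betaStar β) (betaStarStar β) WW).toReal with hN₂
  have hN₁0 : 0 ≤ N₁ := ENNReal.toReal_nonneg
  have hN₂0 : 0 ≤ N₂ := ENNReal.toReal_nonneg
  have hRb : 0 ≤ R ^ b := by positivity
  refine ⟨1 + N₁ * R ^ b + 4 * (N₂ * (R ^ b * R ^ b)), ?_, fun s hs t ht => ?_⟩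
  · have : 0 ≤ N₁ * R ^ b + 4 * (N₂ * (R ^ b * R ^ b)) := by positivity
    linarith
  set B := Metric.closedBall ξ 2 with hB
  have hBc : Convex ℝ B := convex_closedBall ξ 2
  set c := N₁ * R ^ b * |t - s| ^ α with hc
  set d := N₂ * (R ^ b * R ^ b) * |t - s| ^ (2 * α) with hd
  have hd0 : 0 ≤ d := by positivity
  have hf : ∀ k ≤ 3, ∀ x ∈ B, ‖iteratedFDeriv ℝ k (incr W s t) x‖ ≤ c := by
    intro k hk x hx
    refine (norm_iteratedFDeriv_incr_le hW.mem_first.2 hk hs ht x).trans ?_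
    have := hpow (β k) (hle k hk) x hx
    calc _ ≤ N₁ * (|t - s| ^ α * R ^ b) := by gcongr
      _ = c := by rw [hc]; ring
  set B₂ : Set (WithLp 1 (V × V)) := {x | x.fst ∈ B ∧ x.snd ∈ B} with hB₂
  have hB₂c : Convex ℝ B₂ := by
    intro x hx y hy a a' ha ha' haa
    exact ⟨hBc hx.1 hy.1 ha ha' haa, hBc hx.2 hy.2 ha ha' haa⟩
  have hg : ∀ k ≤ 2, ∀ x ∈ B₂, ‖iteratedFDeriv ℝ k (WW s t) x‖ ≤ d := by
    intro k hk x hx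
    rcases eq_or_ne s t with rfl | hst
    · rw [hW.second_self hs, show (0 : WithLp 1 (V × V) → V) = fun _ => 0 from rfl,
        iteratedFDeriv_fun_zero]
      simpa using hd0
    refine (norm_iteratedFDeriv_two_le hW.mem_second.2 hk hs ht hst x).trans ?_
    have h1 := hpow _ (hle' k hk).1 _ hx.1
    have h2 := hpow _ (hle' k hk).2 _ hx.2
    calc _ ≤ N₂ * (|t - s| ^ (2 * α) * R ^ b * R ^ b) := by gcongr
      _ = d := by rw [hd]; ring
  have tf := hW.mem_first.1 s hs t ht
  have tg := hW.mem_second.1 s hs t ht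
  have hgd : Differentiable ℝ (WW s t) := tg.differentiable
  have hgd1 : Differentiable ℝ (fderiv ℝ (WW s t)) := tg.fderiv.differentiable
  have hdiag : ∀ x ∈ B, diagL V x ∈ B₂ := fun x hx => ⟨hx, hx⟩
  have hqd : ∀ x, HasFDerivAt (fun x => WW s t (WithLp.toLp 1 (x, x)))
      ((fderiv ℝ (WW s t) (diagL V x)).comp (diagL V)) x := fun x =>
    (hgd (diagL V x)).hasFDerivAt.comp x (diagL V).hasFDerivAt
  have hg1 : ∀ x ∈ B₂, ‖fderiv ℝ (WW s t) x‖ ≤ d := fun x hx => by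
    have := hg 1 (by norm_num) x hx
    rwa [← norm_iteratedFDeriv_fderiv, norm_iteratedFDeriv_zero] at this
  have hg2 : ∀ x ∈ B₂, ‖fderiv ℝ (fderiv ℝ (WW s t)) x‖ ≤ d := fun x hx => by
    have := hg 2 le_rfl x hx
    rwa [← norm_iteratedFDeriv_fderiv, ← norm_iteratedFDeriv_fderiv,
      norm_iteratedFDeriv_zero] at this
  have hf3 : ∀ x ∈ B, ‖fderiv ℝ (fderiv ℝ (fderiv ℝ (incr W s t))) x‖ ≤ c := fun x hx => by
    have := hf 3 le_rfl x hx
    rwa [← norm_iteratedFDeriv_fderiv, ← norm_iteratedFDeriv_fderiv, ← norm_iteratedFDeriv_fderiv,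
      norm_iteratedFDeriv_zero] at this
  -- Restriction to the diagonal, a map of norm at most `2`, costs a factor `2` per derivative,
  -- hence `4` for the Lipschitz constant of the first derivative.
  have main : LocalBounds B c (4 * d) (incr W s t) (fun x => WW s t (WithLp.toLp 1 (x, x))) :=
    { diff := tf.differentiable
      diff_fderiv := tf.fderiv.differentiable
      diff_second := fun x => (hqd x).differentiableAt
      norm_le := fun x hx => by
        have := hf 0 (by norm_num) x hx
        rwa [norm_iteratedFDeriv_zero] at this
      norm_fderiv_le := fun x hx => by
        have := hf 1 (by norm_num) x hx
        rwa [← norm_iteratedFDeriv_fderiv, norm_iteratedFDeriv_zero] at this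
      norm_fderiv_fderiv_le := fun x hx => by
        have := hf 2 (by norm_num) x hx
        rwa [← norm_iteratedFDeriv_fderiv, ← norm_iteratedFDeriv_fderiv,
          norm_iteratedFDeriv_zero] at this
      lipschitz := fun x hx y hy => hBc.norm_image_sub_le_of_norm_fderiv_le
        (fun z _ => tf.fderiv.fderiv.differentiable z) hf3 hy hx
      norm_second_le := fun x hx => by
        have := hg 0 (by norm_num) _ (hdiag x hx)
        rw [norm_iteratedFDeriv_zero, diagL_apply] at this
        linarith
      norm_fderiv_second_le := fun x hx => by
        rw [(hqd x).fderiv]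
        refine (ContinuousLinearMap.opNorm_comp_le _ _).trans ?_
        have := mul_le_mul (hg1 _ (hdiag x hx)) (norm_diagL_le (V := V)) (norm_nonneg _) hd0
        linarith
      lipschitz_second := fun x hx y hy => by
        rw [(hqd x).fderiv, (hqd y).fderiv, ← ContinuousLinearMap.sub_comp]
        refine (ContinuousLinearMap.opNorm_comp_le _ _).trans ?_
        have h1 : ‖fderiv ℝ (WW s t) (diagL V x) - fderiv ℝ (WW s t) (diagL V y)‖ ≤
            d * ‖diagL V x - diagL V y‖ := hB₂c.norm_image_sub_le_of_norm_fderiv_le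
          (fun z _ => hgd1 z) hg2 (hdiag y hy) (hdiag x hx)
        have h2 : ‖diagL V x - diagL V y‖ ≤ 2 * ‖x - y‖ := by
          rw [← map_sub]
          exact ((diagL V).le_opNorm _).trans (by gcongr; exact norm_diagL_le)
        calc _ ≤ d * (2 * ‖x - y‖) * 2 := by
              gcongr
              · exact h1.trans (by gcongr)
              · exact norm_diagL_le
          _ = _ := by ring }
  refine main.mono ?_ ?_
  · rw [hc]; gcongr
    have : 0 ≤ 4 * (N₂ * (R ^ b * R ^ b)) := by positivity
    linarith
  · rw [hd, ← mul_assoc]; gcongr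
    have : 0 ≤ N₁ * R ^ b := by positivity
    linarith

end IsNonlinearRoughPath

end RoughPath

/-! ### The one-step map is an almost flow -/

section RoughPath

variable {V : Type*} [NormedAddCommGroup V] [NormedSpace ℝ V]

theorem incr_add {E : Type*} [AddCommGroup E] (Φ : ℝ → E) (s u t : ℝ) :
    incr Φ s u + incr Φ u t = incr Φ s t := by
  simp only [incr]; abel

/-- The one-step map `x ↦ x + W_{s,t}(x) + WW_{s,t}(x, x)` of a rough differential equation. -/
def stepMap (W : ℝ → V → V) (WW : ℝ → ℝ → WithLp 1 (V × V) → V) (s t : ℝ) (x : V) : V :=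
  x + incr W s t x + WW s t (WithLp.toLp 1 (x, x))

namespace IsNonlinearRoughPath

variable {α T : ℝ} {β : ℕ → ℝ} {W : ℝ → V → V} {WW : ℝ → ℝ → WithLp 1 (V × V) → V}

theorem second_diag (hW : IsNonlinearRoughPath α T 3 β W WW) {s u t : ℝ} (hs : s ∈ Icc 0 T)
    (hu : u ∈ Icc 0 T) (ht : t ∈ Icc 0 T) (x : V) :
    WW s t (WithLp.toLp 1 (x, x)) = WW s u (WithLp.toLp 1 (x, x)) + WW u t (WithLp.toLp 1 (x, x))
      + fderiv ℝ (incr W u t) x (incr W s u x) := by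
  rw [← hW.chen s hs u hu t ht x x]; abel

/-- Chen's correction is precisely the first-order term of `W_{u,t}` along `W_{s,u}(x)`, the one
term of order only `2α`. -/
theorem stepMap_comp_sub (hW : IsNonlinearRoughPath α T 3 β W WW) {s u t : ℝ} (hs : s ∈ Icc 0 T)
    (hu : u ∈ Icc 0 T) (ht : t ∈ Icc 0 T) (x : V) :
    stepMap W WW u t (stepMap W WW s u x) - stepMap W WW s t x =
      LocalBounds.defect (incr W s u) (fun x => WW s u (WithLp.toLp 1 (x, x))) (incr W u t)
        (fun x => WW u t (WithLp.toLp 1 (x, x))) x := by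
  rw [stepMap, LocalBounds.defect, stepMap, stepMap, hW.second_diag hs hu ht, ← incr_add W s u t,
    Pi.add_apply]
  abel

theorem exists_isAlmostFlow (hW : IsNonlinearRoughPath α T 3 β W WW) (hα : 0 < α) (hT : 0 < T)
    (ξ : V) : ∃ H C, 0 < H ∧ H ≤ T ∧ H ≤ 1 ∧
      IsAlmostFlow α (3 * α) H C ξ (stepMap W WW) ∧
      ∃ M, ∀ s ∈ Icc 0 H, ∀ t ∈ Icc 0 H,
      LocalBounds (Metric.closedBall ξ 2) (M * |t - s| ^ α) (M * |t - s| ^ (2 * α))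
        (incr W s t) (fun x => WW s t (WithLp.toLp 1 (x, x))) := by
  obtain ⟨M, hM, hL⟩ := hW.exists_localBounds ξ
  have hM0 : 0 ≤ M := by linarith
  -- One step then moves a point by at most `1`, so it maps the unit ball into the ball of radius
  -- `2` where the bounds hold.
  obtain ⟨H, hH0, hHT, hHM⟩ : ∃ H : ℝ, 0 < H ∧ H ≤ min T 1 ∧ 2 * M * H ^ α ≤ 1 := by
    have h1 : ∀ᶠ h : ℝ in nhdsWithin 0 (Ioi 0), h ≤ min T 1 :=
      (Filter.tendsto_id.mono_left nhdsWithin_le_nhds).eventually_le_const (by positivity)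
    obtain ⟨H, h2, h3, h4⟩ := (Filter.Eventually.and
      (self_mem_nhdsWithin : Ioi (0 : ℝ) ∈ _)
      (h1.and (eventually_mul_rpow_le hα (2 * M) one_pos))).exists
    exact ⟨H, h2, h3, h4⟩
  have hH1 : H ≤ 1 := hHT.trans (min_le_right _ _)
  replace hHT : H ≤ T := hHT.trans (min_le_left _ _)
  have mem : ∀ {r : ℝ}, 0 ≤ r → r ≤ H → r ∈ Icc 0 T := fun h1 h2 => ⟨h1, h2.trans hHT⟩
  set Q : ℝ → ℝ → V → V := fun s t x => WW s t (WithLp.toLp 1 (x, x)) with hQ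
  -- Allowing any `e` above `(t - s)^α` gives both subintervals of `[s, t]` the same constants, and
  -- the defect bounds become polynomials in `e`.
  have hL' : ∀ s t e, 0 ≤ s → s ≤ t → t ≤ H → (t - s) ^ α ≤ e →
      LocalBounds (Metric.closedBall ξ 2) (M * e) (M * e ^ 2) (incr W s t) (Q s t) := by
    intro s t e hs hst ht he
    refine (hL s (mem hs (hst.trans ht)) t (mem (hs.trans hst) ht)).mono ?_ ?_
    · rw [abs_of_nonneg (sub_nonneg.mpr hst)]
      gcongr
    · rw [abs_of_nonneg (sub_nonneg.mpr hst), mul_comm 2 α, Real.rpow_mul (sub_nonneg.mpr hst),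
        Real.rpow_two]
      have := Real.rpow_nonneg (sub_nonneg.mpr hst) α
      gcongr
  have hpow : ∀ s t, 0 ≤ s → s ≤ t → t ≤ H →
      0 ≤ (t - s) ^ α ∧ (t - s) ^ α ≤ 1 ∧ 2 * M * (t - s) ^ α ≤ 1 := by
    intro s t hs hst ht
    have h0 := Real.rpow_nonneg (sub_nonneg.mpr hst) α
    refine ⟨h0, Real.rpow_le_one (by linarith) (by linarith) hα.le, le_trans ?_ hHM⟩
    gcongr
    linarith
  have hBc : Convex ℝ (Metric.closedBall ξ 2) := convex_closedBall ξ 2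
  have hC : 2 * M ≤ 12 * M ^ 3 := by nlinarith [mul_nonneg hM0 hM0]
  have hC2 : 3 * M ^ 2 ≤ 12 * M ^ 3 := by nlinarith [mul_nonneg hM0 hM0]
  have hsum : ∀ e : ℝ, 0 ≤ e → e ≤ 1 → M * e + M * e ^ 2 ≤ 2 * M * e := by
    intro e h0 h1; nlinarith [mul_nonneg hM0 h0]
  have hsum' : ∀ e : ℝ, 0 ≤ e → e ≤ 1 → M * e + M * e ^ 2 ≤ 12 * M ^ 3 * e :=
    fun e h0 h1 => (hsum e h0 h1).trans (by gcongr)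
  have hstep : ∀ s t x, stepMap W WW s t x - x = incr W s t x + Q s t x := fun s t x => by
    rw [stepMap]; abel
  have hz : ∀ s u, 0 ≤ s → s ≤ u → u ≤ H → ∀ x ∈ Metric.closedBall ξ 1,
      x + incr W s u x + Q s u x ∈ Metric.closedBall ξ 2 := by
    intro s u hs hsu hu x hx
    obtain ⟨h0, h1, h2⟩ := hpow s u hs hsu hu
    have h3 := (hL' s u _ hs hsu hu le_rfl).norm_step_sub_le (IsAlmostFlow.mem_closedBall_two x hx)
    have h4 := hsum _ h0 h1
    rw [mem_closedBall_iff_norm] at hx ⊢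
    rw [← sub_add_sub_cancel _ x]
    exact (norm_add_le _ _).trans (by linarith)
  have hmono : ∀ {s u t : ℝ}, s ≤ u → u ≤ t →
      (u - s) ^ α ≤ (t - s) ^ α ∧ (t - u) ^ α ≤ (t - s) ^ α := fun h1 h2 =>
    ⟨Real.rpow_le_rpow (by linarith) (by linarith) hα.le,
      Real.rpow_le_rpow (by linarith) (by linarith) hα.le⟩
  have hcube : ∀ {s t : ℝ}, s ≤ t → (t - s) ^ (3 * α) = ((t - s) ^ α) ^ 3 := fun hst => by
    rw [mul_comm, Real.rpow_mul (by linarith)]; norm_cast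
  have hpoly : ∀ e : ℝ, 0 ≤ e → e ≤ 1 →
      M * e * (M * e + M * e ^ 2) * (M * e + M * e ^ 2) + 2 * (M * e * (M * e ^ 2))
        + M * e * (M * e + M * e ^ 2) * (M * e) + 2 * (M * e ^ 2 * (M * e + M * e ^ 2)) ≤
      12 * M ^ 3 * e ^ 3 := by
    intro e h0 h1
    have h2 := hsum e h0 h1
    calc _ ≤ M * e * (2 * M * e) * (2 * M * e) + 2 * (M * e * (M * e ^ 2))
        + M * e * (2 * M * e) * (M * e) + 2 * (M * e ^ 2 * (2 * M * e)) := by gcongr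
      _ = 6 * M ^ 3 * e ^ 3 + 6 * M ^ 2 * e ^ 3 := by ring
      _ ≤ 6 * M ^ 3 * e ^ 3 + 6 * M ^ 3 * e ^ 3 := by
        have : M ^ 2 ≤ M ^ 3 := pow_le_pow_right₀ hM (by norm_num)
        gcongr
      _ = _ := by ring
  refine ⟨H, 12 * M ^ 3, hH0, hHT, hH1, ?_, M, fun s hs t ht =>
    hL s (mem hs.1 hs.2) t (mem ht.1 ht.2)⟩
  refine ⟨?_, ?_, ?_, ?_, ?_, ?_⟩
  · intro s t hs hst ht x hx
    obtain ⟨h0, h1, -⟩ := hpow s t hs hst ht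
    rw [hstep]
    exact ((hL' s t _ hs hst ht le_rfl).norm_add_le hx).trans (hsum' _ h0 h1)
  · intro s t hs hst ht x hx y hy
    obtain ⟨h0, h1, -⟩ := hpow s t hs hst ht
    rw [hstep, hstep]
    have := hsum' _ h0 h1
    exact ((hL' s t _ hs hst ht le_rfl).add_lipschitz hBc hx hy).trans (by gcongr)
  · intro s t hs hst ht x hx x' hx' y hy y' hy'
    obtain ⟨h0, h1, -⟩ := hpow s t hs hst ht
    simp only [hstep]
    have := hsum' _ h0 h1
    exact ((hL' s t _ hs hst ht le_rfl).add_four_point hBc hx hx' hy hy').trans (by gcongr)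
  · intro s u t hs hsu hut ht x hx
    obtain ⟨h0, h1, -⟩ := hpow s t hs (hsu.trans hut) ht
    rw [hW.stepMap_comp_sub (mem hs (hsu.trans (hut.trans ht))) (mem (hs.trans hsu) (hut.trans ht))
      (mem (hs.trans (hsu.trans hut)) ht), hcube (hsu.trans hut)]
    refine ((hL' s u _ hs hsu (hut.trans ht) (hmono hsu hut).1).norm_defect_le
      (hL' u t _ (hs.trans hsu) hut ht (hmono hsu hut).2) hBc (IsAlmostFlow.mem_closedBall_two x hx)
      (hz s u hs hsu (hut.trans ht) x hx)).trans (le_trans ?_ (hpoly _ h0 h1))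
    have : 0 ≤ M * (t - s) ^ α * (M * ((t - s) ^ α) ^ 2) := by positivity
    have : 0 ≤ M * (t - s) ^ α * (M * (t - s) ^ α + M * ((t - s) ^ α) ^ 2) * (M * (t - s) ^ α) := by
      positivity
    have : 0 ≤ M * ((t - s) ^ α) ^ 2 * (M * (t - s) ^ α + M * ((t - s) ^ α) ^ 2) := by positivity
    linarith
  · intro s u t hs hsu hut ht x hx y hy
    obtain ⟨h0, h1, -⟩ := hpow s t hs (hsu.trans hut) ht
    rw [hW.stepMap_comp_sub (mem hs (hsu.trans (hut.trans ht))) (mem (hs.trans hsu) (hut.trans ht))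
      (mem (hs.trans (hsu.trans hut)) ht), hW.stepMap_comp_sub (mem hs (hsu.trans (hut.trans ht)))
      (mem (hs.trans hsu) (hut.trans ht)) (mem (hs.trans (hsu.trans hut)) ht),
      hcube (hsu.trans hut)]
    have hD : ∀ z ∈ Metric.closedBall ξ 1, _ := fun z hz1 =>
      (hL' s u _ hs hsu (hut.trans ht) (hmono hsu hut).1).defect_hasFDerivAt
      (hL' u t _ (hs.trans hsu) hut ht (hmono hsu hut).2) hBc (IsAlmostFlow.mem_closedBall_two z hz1)
      (hz s u hs hsu (hut.trans ht) z hz1)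
    refine (convex_closedBall ξ 1).norm_image_sub_le_of_norm_fderiv_le (𝕜 := ℝ)
      (fun z hz1 => ?_) (fun z hz1 => ?_) hy hx
    · obtain ⟨D, hD1, hD2⟩ := hD z hz1
      exact hD1.differentiableAt
    · obtain ⟨D, hD1, hD2⟩ := hD z hz1
      rw [hD1.fderiv]
      exact hD2.trans (hpoly _ h0 h1)
  · intro s s' t t' hs' hss htt hst hst' ht x hx
    have hx2 := IsAlmostFlow.mem_closedBall_two x hx
    have hs0 := hs'.trans hss
    have ht0' := hs'.trans hst'
    have htH' := htt.trans ht
    have hsH := hst.trans ht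
    obtain ⟨hA0, hA1, -⟩ := hpow s' s hs' hss hsH
    obtain ⟨hB0, hB1, -⟩ := hpow t' t ht0' htt ht
    set A := (s - s') ^ α
    set B := (t - t') ^ α
    have hLA := hL' s' s A hs' hss hsH le_rfl
    have hLB := hL' t' t B ht0' htt ht le_rfl
    -- The times `s` and `t'` may come in either order. The bounds depend only on `|t' - s| ≤ 1`,
    -- and Chen's relation needs no ordering, so the contribution between `s` and `t'` cancels in
    -- `e3` in both cases.
    have hLM := (hL s (mem hs0 hsH) t' (mem ht0' htH')).mono (c' := M) (d' := M)
      (mul_le_of_le_one_right hM0 (Real.rpow_le_one (abs_nonneg _)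
        (abs_le.mpr ⟨by linarith, by linarith⟩) hα.le))
      (mul_le_of_le_one_right hM0 (Real.rpow_le_one (abs_nonneg _)
        (abs_le.mpr ⟨by linarith, by linarith⟩) (by positivity)))
    have e1 := hW.second_diag (mem hs' (hss.trans hsH)) (mem hs0 hsH) (mem ht0' htH') x
    have e2 := hW.second_diag (mem hs0 hsH) (mem ht0' htH') (mem (hs0.trans hst) ht) x
    have e3 : stepMap W WW s' t' x - stepMap W WW s t x =
        (incr W s' s x + Q s' s x) - (incr W t' t x + Q t' t x) +
        fderiv ℝ (incr W s t') x (incr W s' s x) - fderiv ℝ (incr W t' t) x (incr W s t' x) := by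
      rw [stepMap, stepMap, e1, e2, ← incr_add W s' s t', ← incr_add W s t' t, Pi.add_apply,
        Pi.add_apply]
      simp only [Q]
      abel
    have b1 := (hLA.norm_add_le hx2).trans (hsum A hA0 hA1)
    have b2 := (hLB.norm_add_le hx2).trans (hsum B hB0 hB1)
    have b3 : ‖fderiv ℝ (incr W s t') x (incr W s' s x)‖ ≤ M * (M * A) :=
      (ContinuousLinearMap.le_opNorm _ _).trans (mul_le_mul (hLM.norm_fderiv_le x hx2)
        (hLA.norm_le x hx2) (norm_nonneg _) hM0)
    have b4 : ‖fderiv ℝ (incr W t' t) x (incr W s t' x)‖ ≤ M * B * M :=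
      (ContinuousLinearMap.le_opNorm _ _).trans (mul_le_mul (hLB.norm_fderiv_le x hx2)
        (hLM.norm_le x hx2) (norm_nonneg _) (by positivity))
    rw [e3]
    have hMM : M ≤ M ^ 2 := by nlinarith
    calc _ ≤ 2 * M * A + 2 * M * B + M * (M * A) + M * B * M :=
          norm_sub_le_of_le (norm_add_le_of_le (norm_sub_le_of_le b1 b2) b3) b4
      _ = (2 * M + M ^ 2) * (A + B) := by ring
      _ ≤ 12 * M ^ 3 * (A + B) := by
        gcongr
        linarith

end IsNonlinearRoughPath

end RoughPath

/-! ### From the path to a solution with the Hölder bound -/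

section RoughPath

theorem holderSeminormTwo_le {E : Type*} [NormedAddCommGroup E] {γ a b C : ℝ} {R : ℝ → ℝ → E}
    (h : ∀ s ∈ Icc a b, ∀ t ∈ Icc a b, ‖R s t‖ ≤ C * |t - s| ^ γ) :
    holderSeminormTwo γ a b R ≤ ENNReal.ofReal C := by
  refine iSup₂_le fun s hs => iSup₂_le fun t ht => iSup_le fun hst => ENNReal.ofReal_le_ofReal ?_
  have : 0 < |t - s| := abs_pos.mpr (sub_ne_zero.mpr hst.symm)
  exact (div_le_iff₀ (by positivity)).mpr (h s hs t ht)

theorem holderSeminorm_le {E : Type*} [NormedAddCommGroup E] {γ a b C : ℝ} {Y : ℝ → E}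
    (h : ∀ s t, a ≤ s → s ≤ t → t ≤ b → ‖Y t - Y s‖ ≤ C * (t - s) ^ γ) :
    holderSeminorm γ a b Y ≤ ENNReal.ofReal C := by
  refine holderSeminormTwo_le fun s hs t ht => ?_
  rcases le_total s t with hst | hst
  · rw [abs_of_nonneg (sub_nonneg.mpr hst)]
    exact h s t hs.1 hst ht.2
  · rw [abs_sub_comm, abs_of_nonneg (sub_nonneg.mpr hst), incr, norm_sub_rev]
    exact h t s ht.1 hst hs.2

variable {V : Type*} [NormedAddCommGroup V]
  {α h K q : ℝ} {W : ℝ → V → V} {WW : ℝ → ℝ → WithLp 1 (V × V) → V} {ξ : V} {Y : ℝ → V}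

/-- A path whose increments agree with the one-step maps to an order `q > 1` is the rough integral
along itself. -/
theorem isRoughIntegral_of_stepMap (hq : 1 < q)
    (hY : ∀ s t, 0 ≤ s → s ≤ t → t ≤ h → ‖Y t - stepMap W WW s t (Y s)‖ ≤ K * (t - s) ^ q)
    {t : ℝ} (ht : t ∈ Icc 0 h) : IsRoughIntegral W WW Y Y 0 t (Y t - Y 0) := by
  intro ε hε
  -- After telescoping, the error of a Riemann sum of mesh below `δ` is at most `|K| t δ^(q - 1)`,
  -- which is small because `q > 1`.
  obtain ⟨δ, hδ, hδε⟩ := (Filter.Eventually.and (self_mem_nhdsWithin : Ioi (0 : ℝ) ∈ _)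
    (eventually_mul_rpow_le (sub_pos.mpr hq) (|K| * t) (half_pos hε))).exists
  have hδ0 : 0 < δ := hδ
  refine ⟨δ, hδ0, fun m π h0 hm hlt hmesh => ?_⟩
  have hmono : ∀ i j, i ≤ j → j ≤ m → π i ≤ π j := by
    intro i j hij
    induction j, hij using Nat.le_induction with
    | base => intro _; exact le_rfl
    | succ j hij ih => intro hj; exact (ih (by omega)).trans (hlt j hj).le
  rw [← hm, ← h0, ← Finset.sum_range_sub (fun k => Y (π k)), ← Finset.sum_sub_distrib]
  have hterm : ∀ k ∈ Finset.range m,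
      ‖incr W (π k) (π (k + 1)) (Y (π k)) + WW (π k) (π (k + 1)) (WithLp.toLp 1 (Y (π k), Y (π k)))
        - (Y (π (k + 1)) - Y (π k))‖ ≤ |K| * δ ^ (q - 1) * (π (k + 1) - π k) := by
    intro k hk
    have hk' : k < m := Finset.mem_range.mp hk
    have h1 := hY (π k) (π (k + 1)) (by rw [← h0]; exact hmono 0 k (Nat.zero_le _) hk'.le)
      (hlt k hk').le ((hmono (k + 1) m hk' le_rfl).trans (hm.le.trans ht.2))
    have hpos : 0 < π (k + 1) - π k := sub_pos.mpr (hlt k hk')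
    rw [norm_sub_rev]
    calc _ = ‖Y (π (k + 1)) - stepMap W WW (π k) (π (k + 1)) (Y (π k))‖ := by
          rw [stepMap]; congr 1; abel
      _ ≤ K * (π (k + 1) - π k) ^ q := h1
      _ ≤ |K| * (π (k + 1) - π k) ^ q := by gcongr; exact le_abs_self K
      _ = |K| * ((π (k + 1) - π k) ^ (q - 1) * (π (k + 1) - π k)) := by
          congr 1
          rw [← Real.rpow_add_one hpos.ne', sub_add_cancel]
      _ ≤ |K| * (δ ^ (q - 1) * (π (k + 1) - π k)) := by
          have := Real.rpow_le_rpow hpos.le (hmesh k hk').le (sub_pos.mpr hq).le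
          gcongr
      _ = _ := by ring
  calc _ ≤ ∑ k ∈ Finset.range m, |K| * δ ^ (q - 1) * (π (k + 1) - π k) := norm_sum_le_of_le _ hterm
    _ = |K| * δ ^ (q - 1) * t := by
        rw [← Finset.mul_sum, Finset.sum_range_sub, hm, h0, sub_zero]
    _ = |K| * t * δ ^ (q - 1) := by ring
    _ ≤ ε / 2 := hδε
    _ < ε := half_lt_self hε

variable [NormedSpace ℝ V]

/-- The controlled remainder is `WW_{s,t}(Y_s, Y_s)` plus the local error, of orders `2α` and `q ≥
2α` on an interval of length at most `1`. -/
theorem isRDESolution_of_stepMap {M B T : ℝ} (hq : 1 < q) (hqα : 2 * α ≤ q) (hα : 0 < α)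
    (hhT : h ≤ T) (hK : 0 ≤ K) (hT : T ≤ 1)
    (hL : ∀ s ∈ Icc 0 T, ∀ t ∈ Icc 0 T,
      LocalBounds (Metric.closedBall ξ 2) (M * |t - s| ^ α) (M * |t - s| ^ (2 * α))
        (incr W s t) (fun x => WW s t (WithLp.toLp 1 (x, x))))
    (h0 : Y 0 = ξ) (hmem : ∀ t ∈ Icc 0 h, Y t ∈ Metric.closedBall ξ 1)
    (hY : ∀ s t, 0 ≤ s → s ≤ t → t ≤ h → ‖Y t - stepMap W WW s t (Y s)‖ ≤ K * (t - s) ^ q)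
    (hB : ∀ s t, 0 ≤ s → s ≤ t → t ≤ h → ‖Y t - Y s‖ ≤ B * (t - s) ^ α) :
    IsRDESolution α h W WW ξ Y := by
  have hhol := (holderSeminorm_le hB).trans_lt ENNReal.ofReal_lt_top
  refine ⟨⟨hhol, hhol, ?_⟩, h0, fun t ht => ⟨Y t - Y 0, isRoughIntegral_of_stepMap hq hY ht, ?_⟩⟩
  · refine (holderSeminormTwo_le (C := K + |M| + |M| * |B|) ?_).trans_lt ENNReal.ofReal_lt_top
    have fwd : ∀ s t, 0 ≤ s → s ≤ t → t ≤ h →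
        ‖incr Y s t - incr W s t (Y s)‖ ≤ (K + |M|) * (t - s) ^ (2 * α) := by
      intro s t hs hst ht
      have hd : 0 ≤ t - s := sub_nonneg.mpr hst
      have h1 := (hL s ⟨hs, by linarith⟩ t ⟨by linarith, by linarith⟩).norm_second_le (Y s)
        (IsAlmostFlow.mem_closedBall_two _ (hmem s ⟨hs, by linarith⟩))
      rw [abs_of_nonneg hd] at h1
      have h2 : (t - s) ^ q ≤ (t - s) ^ (2 * α) := by
        rcases hd.eq_or_lt with hd0 | hd0
        · rw [← hd0, Real.zero_rpow (by linarith), Real.zero_rpow (by linarith)]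
        · exact Real.rpow_le_rpow_of_exponent_ge hd0 (by linarith) hqα
      have h3 := Real.rpow_nonneg hd (2 * α)
      calc _ = ‖(Y t - stepMap W WW s t (Y s)) + WW s t (WithLp.toLp 1 (Y s, Y s))‖ := by
            rw [stepMap, incr]; congr 1; abel
        _ ≤ K * (t - s) ^ q + M * (t - s) ^ (2 * α) :=
            norm_add_le_of_le (hY s t hs hst ht) h1
        _ ≤ K * (t - s) ^ (2 * α) + |M| * (t - s) ^ (2 * α) := by
            gcongr
            exact le_abs_self M
        _ = _ := by ring
    intro s hs t ht
    have hnn : 0 ≤ |M| * |B| * |t - s| ^ (2 * α) := by positivity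
    rcases le_total s t with hst | hst
    · refine (fwd s t hs.1 hst ht.2).trans ?_
      rw [abs_of_nonneg (sub_nonneg.mpr hst)] at *
      linarith
    · have h1 := fwd t s ht.1 hst hs.2
      have h2 := hB t s ht.1 hst hs.2
      have hL' := hL t ⟨ht.1, ht.2.trans hhT⟩ s ⟨hs.1, hs.2.trans hhT⟩
      rw [abs_sub_comm]
      have hd : 0 ≤ s - t := sub_nonneg.mpr hst
      rw [abs_of_nonneg hd] at hL' ⊢
      have h3 : ‖incr W t s (Y s) - incr W t s (Y t)‖ ≤ M * (s - t) ^ α * ‖Y s - Y t‖ :=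
        (convex_closedBall ξ 2).norm_image_sub_le_of_norm_fderiv_le (fun z _ => hL'.diff z)
          hL'.norm_fderiv_le (IsAlmostFlow.mem_closedBall_two _ (hmem t ht))
          (IsAlmostFlow.mem_closedBall_two _ (hmem s hs))
      have h4 : (s - t) ^ (2 * α) = (s - t) ^ α * (s - t) ^ α := by
        rw [two_mul]; exact Real.rpow_add_of_nonneg hd hα.le hα.le
      have h5 := Real.rpow_nonneg hd α
      -- For `t ≤ s` the base point is the later one. Moving it to `Y t` costs the Lipschitz
      -- constant of `W_{t,s}` times `‖Y s - Y t‖`, of order `α + α`.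
      have e : incr Y s t - incr W s t (Y s) =
          -(incr Y t s - incr W t s (Y t)) + (incr W t s (Y s) - incr W t s (Y t)) := by
        simp only [incr, Pi.sub_apply]; abel
      rw [e]
      refine (norm_add_le_of_le ((norm_neg _).le.trans h1) h3).trans ?_
      calc _ ≤ (K + |M|) * (s - t) ^ (2 * α) + |M| * (s - t) ^ α * (|B| * (s - t) ^ α) := by
            gcongr
            · exact le_abs_self M
            · exact h2.trans (by gcongr; exact le_abs_self B)
        _ = _ := by rw [h4]; ring
  · rw [h0]; abel

theorem eventually_growth_bound {N r b C M K a B : ℝ} (hr : 0 ≤ r) (ha : 0 < a) {c : ℝ} (hc : 0 < c)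
    (hB : N * (1 + r) ^ b < B) :
    ∀ᶠ h : ℝ in nhdsWithin 0 (Ioi 0),
      N * (1 + (r + C * h ^ a)) ^ b + M * h ^ a + K * h ^ c ≤ B := by
  have hp : ∀ e : ℝ, 0 < e → Filter.Tendsto (fun h : ℝ => h ^ e) (nhds 0) (nhds 0) := by
    intro e he
    have := (Real.continuousAt_rpow_const 0 e (Or.inr he.le)).tendsto
    rwa [Real.zero_rpow he.ne'] at this
  have h1 : Filter.Tendsto (fun h : ℝ => N * (1 + (r + C * h ^ a)) ^ b + M * h ^ a + K * h ^ c)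
      (nhds 0) (nhds (N * (1 + (r + C * 0)) ^ b + M * 0 + K * 0)) := by
    refine Filter.Tendsto.add (Filter.Tendsto.add (Filter.Tendsto.const_mul _ ?_)
      ((hp a ha).const_mul _)) ((hp c hc).const_mul _)
    exact ((((hp a ha).const_mul C).const_add r).const_add 1).rpow_const
      (Or.inl (by simp only [mul_zero, add_zero]; positivity))
  refine (h1.mono_left nhdsWithin_le_nhds).eventually_le_const ?_
  simpa using hB

namespace IsNonlinearRoughPath

variable {T : ℝ} {β : ℕ → ℝ}

/-- Local existence, with a Hölder seminorm as close as desired to the growth bound of the driver at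
the initial point. -/
theorem exists_solution [CompleteSpace V] (hW : IsNonlinearRoughPath α T 3 β W WW)
    (hα : 1 / 3 < α) (hα' : α ≤ 1 / 2) (hT : 0 < T) (hβ : 0 ≤ β 0) (ξ : V) {B : ℝ}
    (hB : roughPathNorm α T 3 β W WW * (1 + ‖ξ‖) ^ β 0 < B) :
    ∃ h : ℝ, 0 < h ∧ h ≤ T ∧ ∃ Y : ℝ → V, IsRDESolution α h W WW ξ Y ∧
      holderSeminorm α 0 h Y ≤ ENNReal.ofReal B := by
  have hα0 : 0 < α := by linarith
  set N := roughPathNorm α T 3 β W WW with hN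
  have hN0 : 0 ≤ N := ENNReal.toReal_nonneg
  obtain ⟨H, C, hH0, hHT, hH1, hφ, M, hL⟩ := hW.exists_isAlmostFlow hα0 hT ξ
  -- The midpoint of `1` and `3α`: sewing needs `1 < q`, the Cauchy rate needs `q < 3α`, and `q ≥
  -- 2α` because `α ≤ 1`.
  set q : ℝ := (1 + 3 * α) / 2 with hq
  have hq1 : 1 < q := by linarith
  obtain ⟨h₀, hh₀, hh₀H, K, Y, hK, hY0, hmem, hY⟩ := hφ.exists_path hα0 hq1 (by linarith) hH0
  have hξ : ξ ∈ Metric.closedBall ξ 2 := Metric.mem_closedBall_self two_pos.le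
  have hev : ∀ᶠ h : ℝ in nhdsWithin 0 (Ioi 0), h ≤ h₀ :=
    (Filter.tendsto_id.mono_left nhdsWithin_le_nhds).eventually_le_const hh₀
  -- The path is kept and only its horizon shrinks, until the drift of `‖Y s‖` from `‖ξ‖` and the
  -- terms of order above `α` fit into the gap between `N (1 + ‖ξ‖)^β₀` and `B`.
  obtain ⟨h, hh, hhh₀, hhB⟩ := (Filter.Eventually.and (self_mem_nhdsWithin : Ioi (0 : ℝ) ∈ _)
    (hev.and (eventually_growth_bound (C := C + K) (M := |M|) (K := K) (norm_nonneg ξ) hα0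
      (by linarith : 0 < q - α) hB))).exists
  have hh0 : 0 < h := hh
  have hC := hφ.nonneg hH0
  have hh1 : h ≤ 1 := hhh₀.trans (hh₀H.trans hH1)
  have hle1 : ∀ s, 0 ≤ s → s ≤ h → ‖Y s‖ ≤ ‖ξ‖ + (C + K) * h ^ α := by
    intro s hs hsh
    have h1 := hY 0 s le_rfl hs (hsh.trans hhh₀)
    have h2 := hφ.norm_sub_le 0 s le_rfl hs (hsh.trans (hhh₀.trans hh₀H)) ξ hξ
    rw [hY0, sub_zero] at h1
    rw [sub_zero] at h2
    have h3 : s ^ α ≤ h ^ α := Real.rpow_le_rpow hs hsh hα0.le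
    have h4 : s ^ q ≤ h ^ α := (Real.rpow_le_rpow hs hsh (by linarith)).trans
      (Real.rpow_le_rpow_of_exponent_ge hh0 hh1 (by linarith))
    calc ‖Y s‖ = ‖ξ + ((Y s - stepMap W WW 0 s ξ) + (stepMap W WW 0 s ξ - ξ))‖ := by
          congr 1; abel
      _ ≤ ‖ξ‖ + (K * s ^ q + C * s ^ α) := norm_add_le_of_le le_rfl (norm_add_le_of_le h1 h2)
      _ ≤ ‖ξ‖ + (K * h ^ α + C * h ^ α) := by gcongr
      _ = _ := by ring
  have hhol : ∀ s t, 0 ≤ s → s ≤ t → t ≤ h → ‖Y t - Y s‖ ≤ B * (t - s) ^ α := by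
    intro s t hs hst ht
    rcases hst.eq_or_lt with rfl | hlt
    · simp [Real.zero_rpow hα0.ne']
    have hd : 0 < t - s := sub_pos.mpr hlt
    have hdh : t - s ≤ h := by linarith
    have hsh : s ≤ h := hst.trans ht
    have hhH : h ≤ H := hhh₀.trans hh₀H
    have h1 := hY s t hs hst (ht.trans hhh₀)
    have h2 := hW.norm_incr_le ⟨hs, by linarith⟩ ⟨hs.trans hst, by linarith⟩ (Y s)
    have h3 := (hL s ⟨hs, by linarith⟩ t ⟨by linarith, by linarith⟩).norm_second_le (Y s)
      (IsAlmostFlow.mem_closedBall_two _ (hmem s ⟨hs, by linarith⟩))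
    rw [abs_of_pos hd] at h2 h3
    have h4 : (1 + ‖Y s‖) ^ β 0 ≤ (1 + (‖ξ‖ + (C + K) * h ^ α)) ^ β 0 :=
      Real.rpow_le_rpow (by positivity) (by linarith [hle1 s hs hsh]) hβ
    have h5 : (t - s) ^ (2 * α) ≤ h ^ α * (t - s) ^ α := by
      rw [two_mul, Real.rpow_add hd]
      gcongr
    have h6 : (t - s) ^ q ≤ h ^ (q - α) * (t - s) ^ α := by
      have : (t - s) ^ (q - α) ≤ h ^ (q - α) := Real.rpow_le_rpow hd.le hdh (by linarith)
      calc (t - s) ^ q = (t - s) ^ (q - α) * (t - s) ^ α := by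
            rw [← Real.rpow_add hd, sub_add_cancel]
        _ ≤ _ := by gcongr
    calc ‖Y t - Y s‖ = ‖incr W s t (Y s) + WW s t (WithLp.toLp 1 (Y s, Y s)) +
            (Y t - stepMap W WW s t (Y s))‖ := by rw [stepMap]; congr 1; abel
      _ ≤ N * ((t - s) ^ α * (1 + ‖Y s‖) ^ β 0) + M * (t - s) ^ (2 * α) + K * (t - s) ^ q :=
          norm_add_le_of_le (norm_add_le_of_le h2 h3) h1
      _ ≤ N * ((t - s) ^ α * (1 + (‖ξ‖ + (C + K) * h ^ α)) ^ β 0) +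
            |M| * (h ^ α * (t - s) ^ α) + K * (h ^ (q - α) * (t - s) ^ α) := by
          have := le_abs_self M
          gcongr
      _ = (N * (1 + (‖ξ‖ + (C + K) * h ^ α)) ^ β 0 + |M| * h ^ α + K * h ^ (q - α))
            * (t - s) ^ α := by ring
      _ ≤ B * (t - s) ^ α := by gcongr
  exact ⟨h, hh0, hhh₀.trans (hh₀H.trans hHT), Y,
    isRDESolution_of_stepMap hq1 (by linarith) hα0 (hhh₀.trans hh₀H) hK hH1 hL hY0
      (fun t ht => hmem t ⟨ht.1, ht.2.trans hhh₀⟩)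
      (fun s t hs hst ht => hY s t hs hst (ht.trans hhh₀)) hhol, holderSeminorm_le hhol⟩

/-- A rough path of norm zero is solved by constant paths. -/
theorem exists_solution_of_norm_eq_zero (hW : IsNonlinearRoughPath α T 3 β W WW)
    (hα : 1 / 3 < α) (hT : 0 < T) (ξ : V)
    (hN : roughPathNorm α T 3 β W WW = 0) :
    ∃ h : ℝ, 0 < h ∧ h ≤ T ∧ ∃ Y : ℝ → V, IsRDESolution α h W WW ξ Y ∧
      holderSeminorm α 0 h Y ≤ ENNReal.ofReal 0 := by
  obtain ⟨H, C, hH0, hHT, hH1, hφ, M, hL⟩ := hW.exists_isAlmostFlow (by linarith) hT ξ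
  have hhol : ∀ s t, 0 ≤ s → s ≤ t → t ≤ H → ‖ξ - ξ‖ ≤ 0 * (t - s) ^ α := by simp
  refine ⟨H, hH0, hHT, fun _ => ξ, isRDESolution_of_stepMap (q := 3 * α) (K := 0) (by linarith)
    (by linarith) (by linarith) le_rfl le_rfl hH1 hL rfl (fun t _ => by simp) ?_ hhol,
    holderSeminorm_le hhol⟩
  intro s t hs hst ht
  have hs' : s ∈ Icc 0 T := ⟨hs, by linarith⟩
  have ht' : t ∈ Icc 0 T := ⟨by linarith, by linarith⟩
  have h1 := hW.norm_incr_le hs' ht' ξ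
  have h2 := hW.norm_second_le hs' ht' (WithLp.toLp 1 (ξ, ξ))
  rw [hN, zero_mul, norm_le_zero_iff] at h1 h2
  simp [stepMap, h1, h2]

end IsNonlinearRoughPath

theorem one_lt_kConst {α : ℝ} (hα : 1 / 3 < α) : 1 < kConst α := by
  have h1 : (2 : ℝ) ^ (1 - 3 * α) < 1 :=
    Real.rpow_lt_one_of_one_lt_of_neg one_lt_two (by linarith)
  have h2 : 0 < (2 : ℝ) ^ (1 - 3 * α) := by positivity
  exact (one_lt_inv₀ (by linarith)).mpr (by linarith)

/-- The a priori bound of the theorem strictly exceeds the growth bound of the driver. -/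
theorem growth_lt_bound {α N r : ℝ} {β : ℕ → ℝ} (hα : 1 / 3 < α) (hβ : ∀ k ≤ 3, 0 ≤ β k)
    (hN : 0 < N) (hr : 0 ≤ r) (hγ : 0 < gammaOne β) :
    N * (1 + r) ^ β 0 < min ((1 + (6 * gammaOne β)⁻¹) ^ (1 + β 0) * (1 + N) * (1 + r) ^ β 0)
      (2 * kConst α * ((1 + gammaOne β) / gammaOne β) ^ (1 + gammaOne β) * N
        * (1 + 2 * r) ^ gammaOne β) := by
  have hβ0 := hβ 0 (by norm_num)
  set γ := gammaOne β with hγdef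
  have hγβ : β 0 ≤ γ := by
    have h1 : β 0 ≤ max (β 0) (β 1) := le_max_left _ _
    have h2 : 0 ≤ max (β 1) (β 2) := (hβ 1 (by norm_num)).trans (le_max_left _ _)
    rw [hγdef, gammaOne]
    linarith
  have hX : 0 < (1 + r) ^ β 0 := by positivity
  -- Strictness comes from `N < 1 + N` in the first bound, and from `2 k_α > 2` together with `β₀ ≤
  -- γ₁` in the second.
  refine lt_min ?_ ?_
  · have h1 : 1 ≤ (1 + (6 * γ)⁻¹) ^ (1 + β 0) := Real.one_le_rpow
      (le_add_of_nonneg_right (by positivity)) (by linarith)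
    gcongr
    nlinarith
  · have hk := one_lt_kConst hα
    have h1 : 1 ≤ ((1 + γ) / γ) ^ (1 + γ) := Real.one_le_rpow
      (by rw [le_div_iff₀ hγ]; linarith) (by linarith)
    have h2 : (1 + r) ^ β 0 ≤ (1 + 2 * r) ^ γ :=
      (Real.rpow_le_rpow_of_exponent_le (by linarith) hγβ).trans
        (Real.rpow_le_rpow (by linarith) (by linarith) hγ.le)
    have h3 : 1 < 2 * kConst α * ((1 + γ) / γ) ^ (1 + γ) := by nlinarith
    calc N * (1 + r) ^ β 0 < 2 * kConst α * ((1 + γ) / γ) ^ (1 + γ) * (N * (1 + r) ^ β 0) :=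
          lt_mul_of_one_lt_left (by positivity) h3
      _ = 2 * kConst α * ((1 + γ) / γ) ^ (1 + γ) * N * (1 + r) ^ β 0 := by ring
      _ ≤ _ := by gcongr

end RoughPath

theorem theorem4p1 {V : Type*} [NormedAddCommGroup V] [NormedSpace ℝ V] [CompleteSpace V]
    [TopologicalSpace.SeparableSpace V]
    (α T : ℝ) (hα : 1 / 3 < α) (hα' : α ≤ 1 / 2) (hT : 0 < T)
    (β : ℕ → ℝ) (hβ : ∀ k ≤ 3, 0 ≤ β k)
    (W : ℝ → V → V) (WW : ℝ → ℝ → WithLp 1 (V × V) → V)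
    (hW : IsNonlinearRoughPath α T 3 β W WW) (ξ : V) :
    ∃ h : ℝ, 0 < h ∧ h ≤ T ∧ ∃ Y : ℝ → V,
      IsRDESolution α h W WW ξ Y ∧
      (0 < gammaOne β →
        holderSeminorm α 0 h Y ≤ ENNReal.ofReal (min
          ((1 + (6 * gammaOne β)⁻¹) ^ (1 + β 0) * (1 + roughPathNorm α T 3 β W WW)
            * (1 + ‖ξ‖) ^ β 0)
          (2 * kConst α * ((1 + gammaOne β) / gammaOne β) ^ (1 + gammaOne β)
            * roughPathNorm α T 3 β W WW * (1 + 2 * ‖ξ‖) ^ gammaOne β))) := by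
  have hN : 0 ≤ roughPathNorm α T 3 β W WW := ENNReal.toReal_nonneg
  have hβ0 := hβ 0 (by norm_num)
  -- For a driver of norm zero the second bound is `0` and leaves no gap, so this case uses a
  -- constant path.
  rcases hN.eq_or_lt with hN | hN
  · obtain ⟨h, h0, hT, Y, hY, hb⟩ := hW.exists_solution_of_norm_eq_zero hα hT ξ hN.symm
    refine ⟨h, h0, hT, Y, hY, fun _ => hb.trans ?_⟩
    rw [ENNReal.ofReal_zero]
    exact zero_le
  by_cases hγ : 0 < gammaOne β
  · obtain ⟨h, h0, hT, Y, hY, hb⟩ := hW.exists_solution hα hα' hT hβ0 ξ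
      (growth_lt_bound hα hβ hN (norm_nonneg ξ) hγ)
    exact ⟨h, h0, hT, Y, hY, fun _ => hb⟩
  -- No bound is claimed here, so any admissible `B` serves.
  · obtain ⟨h, h0, hT, Y, hY, -⟩ := hW.exists_solution hα hα' hT hβ0 ξ (lt_add_one _)
    exact ⟨h, h0, hT, Y, hY, fun h => absurd h hγ⟩
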